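/- Let $n\ge 0$, let $d_1,\dots,d_n\ge 0$ be integers such that $t:=\sum_{i=1}^n d_i-n+1\ge 0$ (automatic if all $d_i\ge1$), and put $N=\prod_{i=1}^n d_i$. For nonzero $f_1,\dots,f_n\in\mathbb C[x]=\mathbb C[x_1,\dots,x_n]$ with $\deg f_i=d_i$ let $I=\langle f_1,\dots,f_n\rangle$, let $f_i^h=x_0^{d_i}f_i(x_1/x_0,\dots,x_n/x_0)$ be the homogenizations, and call the system *generic* if $f_1^h=\dots=f_n^h=0$ has finitely many solutions in $\mathbb P^n$, none of which lies on the hyperplane at infinity $\{x_0=0\}$ (by Bézout's theorem it then has exactly $N$ solutions in $\mathbb C^n$, counted with multiplicities). The dense Macaulay matrix $M$ of degree $t$ has one column for each monomial $x^\alpha$ with $|\alpha|\le t$ (the set of these is $S(M)$) and one row for each pair $(i,\beta)$ with $\beta\in\mathbb Z_{\ge0}^n$, $|\beta|\le t-d_i$, namely the coefficient vector of $x^\beta f_i$. Let $r=\operatorname{rank}(M)$, and let $M_b$ be the block of the columns of the monomials of degree exactly $t$. For a set $\mathcal O$ of monomials of degree $<t$, let $M_i$ be the block of the columns of the monomials of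 degree $<t$ that are not in $\mathcal O$. Call $\mathcal O$ *admissible* for $f_1,\dots,f_n$ if all of the following hold: - $\mathcal O$ consists of $N$ monomials of degree $<t$, and $\operatorname{rank}\begin{bmatrix}M_b & M_i\end{bmatrix}=r$; - the residue classes of the monomials in $\mathcal O$ form a basis of $\mathbb C[x]/I$; - every $x^\alpha\in S(M)\setminus\mathcal O$ has a unique normal form with respect to $\mathcal O$, that is, there is a unique $h\in\operatorname{span}_{\mathbb C}(\mathcal O)$ with $x^\alpha-h\in I$; moreover the coefficient vector of $x^\alpha-h$ is a linear combination of the rows of $M$. Let $\mathcal O_M=\{x^\alpha : 0\le\alpha_i\le d_i-1,\ 1\le i\le n\}$. Then: 1. For every generic system $f_1,\dots,f_n$ of degree $(d_1,\dots,d_n)$, the matrix $M_b$ has full column rank, and there is an admissible set $\mathcal O$. Moreover, if $\mathcal O_M$ represents a basis of $\mathbb C[x]/I$, then $\mathcal O_M$ is admissible. 2. For almost all systems the choice $\mathcal O=\mathcal O_M$ is possible: there is a nonzero polynomial $P$ in the coefficients of $f_1,\dots,f_n$ (one variable for each $i$ and each $\alpha$ with $|\alpha|\le d_i$) such that every system with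 $\deg f_i\le d_i$ at whose coefficients $P$ does not vanish is a generic system of degree $(d_1,\dots,d_n)$ for which $\mathcal O_M$ is admissible. -/

import Mathlib

open MvPolynomial

noncomputable section

namespace Macaulay

variable {n : ℕ}

/-- The exponent vectors `α ∈ ℤ_{≥0}^n` with `|α| ≤ t`. -/
def degreeLE (n t : ℕ) : Finset (Fin n →₀ ℕ) :=
  (Finsupp.finite_of_degree_le (σ := Fin n) t).toFinset

theorem mem_degreeLE {t : ℕ} {α : Fin n →₀ ℕ} : α ∈ degreeLE n t ↔ α.degree ≤ t := by
  simp [degreeLE]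

/-! ### Square systems and their projective solutions -/

/-- The homogenization `f^h = x_0^{deg f} f(x_1/x_0, …, x_n/x_0)`: every monomial `x^α` of `f` is
multiplied by `x_0^{deg f - |α|}` (note that `|α| ≤ deg f` on the support of `f`). -/
def homogenization (f : MvPolynomial (Fin n) ℂ) : MvPolynomial (Fin (n + 1)) ℂ :=
  ∑ α ∈ f.support, monomial (Finsupp.cons (f.totalDegree - α.degree) α) (f.coeff α)

theorem degree_cons (k : ℕ) (α : Fin n →₀ ℕ) : (Finsupp.cons k α).degree = k + α.degree := by
  simp [Finsupp.degree_eq_sum, Fin.sum_univ_succ]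

theorem isHomogeneous_homogenization (f : MvPolynomial (Fin n) ℂ) :
    (homogenization f).IsHomogeneous f.totalDegree := by
  refine IsHomogeneous.sum _ _ _ fun α hα => isHomogeneous_monomial _ ?_
  have h : α.degree ≤ f.totalDegree := by
    simpa [Finsupp.degree_apply, Finsupp.sum] using le_totalDegree hα
  rw [degree_cons]
  omega

/-- The common zeros in `ℙⁿ` of the homogenized equations `f_1^h = ⋯ = f_n^h = 0`. -/
def projectiveZeros (f : Fin n → MvPolynomial (Fin n) ℂ) :
    Set (Projectivization ℂ (Fin (n + 1) → ℂ)) :=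
  {z | ∀ i, eval z.rep (homogenization (f i)) = 0}

/-- Membership of a point in the zero set can be tested on any homogeneous coordinate vector. -/
theorem mk_mem_projectiveZeros (f : Fin n → MvPolynomial (Fin n) ℂ) (v : Fin (n + 1) → ℂ)
    (hv : v ≠ 0) : Projectivization.mk ℂ v hv ∈ projectiveZeros f ↔
      ∀ i, eval v (homogenization (f i)) = 0 := by
  obtain ⟨a, ha⟩ := Projectivization.exists_smul_eq_mk_rep ℂ v hv
  refine forall_congr' fun i => ?_
  have key : eval ((a : ℂ) • v) (homogenization (f i)) =
      (a : ℂ) ^ (f i).totalDegree * eval v (homogenization (f i)) := by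
    rw [eval_eq, eval_eq, Finset.mul_sum]
    refine Finset.sum_congr rfl fun α hα => ?_
    have hd := isHomogeneous_homogenization (f i) (mem_support_iff.1 hα)
    have hs : ∑ j ∈ α.support, α j = (f i).totalDegree := by
      simpa [Finsupp.weight_apply, Finsupp.sum] using hd
    simp only [Pi.smul_apply, smul_eq_mul, mul_pow, Finset.prod_mul_distrib,
      Finset.prod_pow_eq_pow_sum, hs]
    ring
  rw [← ha]
  change eval ((a : ℂ) • v) _ = 0 ↔ _
  rw [key]
  simp

/-- A square system `f_1, …, f_n ∈ ℂ[x_1, …, x_n]` of degree `(d_1, …, d_n)` whose homogenized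
equations have finitely many solutions in `ℙⁿ`, none of them on the hyperplane at infinity
`x_0 = 0`. -/
structure IsGenericSystem (d : Fin n → ℕ) (f : Fin n → MvPolynomial (Fin n) ℂ) : Prop where
  ne_zero : ∀ i, f i ≠ 0
  totalDegree_eq : ∀ i, (f i).totalDegree = d i
  finite_zeros : (projectiveZeros f).Finite
  not_at_infinity : ∀ z ∈ projectiveZeros f, z.rep 0 ≠ 0

/-! ### The dense Macaulay matrix -/

/-- The columns of the dense Macaulay matrix of degree `t`: the support `S(M)`. -/
abbrev Col (n t : ℕ) : Type := degreeLE n t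

/-- The rows of the dense Macaulay matrix of degree `t`: pairs of an index `i` and a shift `β`
with `|β| ≤ t - d_i`. -/
abbrev Row (d : Fin n → ℕ) (t : ℕ) : Type :=
  Σ i : Fin n, {β : Fin n →₀ ℕ // β.degree + d i ≤ t}

/-- The dense Macaulay matrix `M` of degree `t`: the row `(i, β)` is the coefficient vector of
`x^β f_i`. -/
def denseMatrix (d : Fin n → ℕ) (f : Fin n → MvPolynomial (Fin n) ℂ) (t : ℕ) :
    Matrix (Row d t) (Col n t) ℂ :=
  Matrix.of fun ρ α => coeff (α : Fin n →₀ ℕ) (monomial (ρ.2 : Fin n →₀ ℕ) 1 * f ρ.1)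

/-- The block `M_b` of the columns that belong to the monomials of degree exactly `t`. -/
def borderBlock (d : Fin n → ℕ) (f : Fin n → MvPolynomial (Fin n) ℂ) (t : ℕ) :
    Matrix (Row d t) {α : Col n t // (α : Fin n →₀ ℕ).degree = t} ℂ :=
  (denseMatrix d f t).submatrix id Subtype.val

/-- The block `M_i` of the columns that belong to the monomials of degree `< t` outside `O`. -/
def interiorBlock (d : Fin n → ℕ) (f : Fin n → MvPolynomial (Fin n) ℂ) (t : ℕ)
    (O : Finset (Col n t)) :
    Matrix (Row d t) {α : Col n t // (α : Fin n →₀ ℕ).degree < t ∧ α ∉ O} ℂ :=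
  (denseMatrix d f t).submatrix id Subtype.val

/-! ### Monomial bases and normal forms -/

/-- The ideal `I = ⟨f_1, …, f_n⟩`. -/
def systemIdeal (f : Fin n → MvPolynomial (Fin n) ℂ) : Ideal (MvPolynomial (Fin n) ℂ) :=
  Ideal.span (Set.range f)

/-- The residue classes of the monomials in `O` form a basis of the vector space `ℂ[x]/I`. -/
def IsQuotientBasis {t : ℕ} (f : Fin n → MvPolynomial (Fin n) ℂ) (O : Finset (Col n t)) : Prop :=
  let b : O → MvPolynomial (Fin n) ℂ ⧸ systemIdeal f := fun α =>
    Ideal.Quotient.mk (systemIdeal f) (monomial (α.1 : Fin n →₀ ℕ) 1)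
  LinearIndependent ℂ b ∧ Submodule.span ℂ (Set.range b) = ⊤

/-- `h` is a normal form of `g` with respect to the monomials in `O`: a linear combination of
these monomials with `g - h ∈ I`. -/
def IsNormalForm {t : ℕ} (f : Fin n → MvPolynomial (Fin n) ℂ) (O : Finset (Col n t))
    (g h : MvPolynomial (Fin n) ℂ) : Prop :=
  h ∈ Submodule.span ℂ
      (Set.range fun α : O => (monomial (α.1 : Fin n →₀ ℕ) 1 : MvPolynomial (Fin n) ℂ)) ∧
    g - h ∈ systemIdeal f

/-- `O` consists of `N = d_1 ⋯ d_n` monomials of degree `< t` that form a basis of `ℂ[x]/I`, the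
matrix `[M_b  M_i]` has the same rank as `M`, and every monomial of `S(M)` outside `O` has a unique
normal form `h` with respect to `O`, with `x^α - h` a linear combination of the rows of `M`. -/
structure IsBasisChoice (d : Fin n → ℕ) (f : Fin n → MvPolynomial (Fin n) ℂ) (t : ℕ)
    (O : Finset (Col n t)) : Prop where
  degree_lt : ∀ α ∈ O, (α : Fin n →₀ ℕ).degree < t
  card_eq : O.card = ∏ i, d i
  rank_eq : (Matrix.fromCols (borderBlock d f t) (interiorBlock d f t O)).rank =
    (denseMatrix d f t).rank
  basis : IsQuotientBasis f O
  normalForm : ∀ α : Col n t, α ∉ O →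
    ∃ h : MvPolynomial (Fin n) ℂ,
      IsNormalForm f O (monomial (α : Fin n →₀ ℕ) 1) h ∧
      (∀ h', IsNormalForm f O (monomial (α : Fin n →₀ ℕ) 1) h' → h' = h) ∧
      (fun γ : Col n t => coeff (γ : Fin n →₀ ℕ) (monomial (α : Fin n →₀ ℕ) 1 - h)) ∈
        Submodule.span ℂ (Set.range (denseMatrix d f t).row)

/-- The box `O_M` of the monomials `x^α` with `0 ≤ α_i ≤ d_i - 1` for all `i`. For
`t = d_1 + ⋯ + d_n - n + 1` all of them lie in `S(M)`. -/
def box (d : Fin n → ℕ) (t : ℕ) : Finset (Col n t) :=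
  {α : Col n t | ∀ i, (α : Fin n →₀ ℕ) i < d i}

/-- The coefficients of a system of degrees at most `(d_1, …, d_n)`: one for each `i` and each
exponent vector `α` with `|α| ≤ d_i`. -/
def coeffVector (d : Fin n → ℕ) (f : Fin n → MvPolynomial (Fin n) ℂ) :
    (Σ i : Fin n, degreeLE n (d i)) → ℂ :=
  fun p => coeff (p.2 : Fin n →₀ ℕ) (f p.1)

end Macaulay

end

/-!
The ideal `I` of a generic system is controlled by the system of `n + 1` forms `x_0, f_1^h, …, f_n^h`
in `n + 1` variables. Genericity says that these forms have no common zero in projective space, at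
least if all `d_i` are positive; if some `d_i` vanishes, then `I` is the unit ideal, already by
constant cofactors.

The main algebraic input is that a square system of forms of positive degrees without a common
projective zero is a regular sequence in every order (`HasOnlyTrivialZero.isPermRegular`). No
Cohen–Macaulay theory is needed. Linear forms without a common zero are coordinates, and members of
the system can be exchanged for linear forms one at a time: if `J` is generated by the other members
and `l` is a linear form that is regular modulo `J` with `J + (l)` of finite colength, then
multiplication by `l` is bijective on `R / J` in large degrees, so the Hilbert function of `R / J` is
eventually constant. Multiplication by the original member `g` is surjective in large degrees, since
`J + (g)` has finite colength by the Nullstellensatz, so it is bijective there, and then `g` is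
regular modulo `J` (`regular_of_eventually_surjective`). The linear form exists because the other
members vanish on finitely many lines only.

Consequently the Hilbert functions are those of the pure powers `x_i^{d_i}`
(`HasOnlyTrivialZero.finrank_formsIn`), where they count monomials. Dehomogenizing gives the three
facts collected in `IsResolvedInDegree`: the row space of `M` is the part of `I` of degree at most
`t`, because `x_0` is regular modulo the homogenized system; the rows reduce all monomials of degree
`t` to smaller degree, because no monomial of degree `t` lies in the box; and `ℂ[x]/I` has dimension
`∏ d_i`, the number of monomials in the box. All properties of the Macaulay matrix of a generic
system then follow by linear algebra (`borderBlock_rank`, `IsResolvedInDegree.isBasisChoice`).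

For almost all systems the box works: the product of the coefficients of the `x_i^{d_i}` with two
minors of the generic Macaulay matrix, one for the columns of degree `t` and one for the columns
outside the box, is a nonzero polynomial, since it takes the value `1` at the system `x_i^{d_i}`.
The first minor forces genericity, the second makes the box span the quotient
(`exists_polynomial_isGenericSystem`).
-/

namespace Macaulay

/-! ### Permutable regular sequences of homogeneous polynomials -/

section Regular

variable {σ ι k : Type*} [Field k]

/-- A family `h` is permutably regular if it is a weakly regular sequence in every order: each
member is a nonzerodivisor modulo the ideal generated by any set of other members. -/
def IsPermRegular {A : Type*} [CommRing A] (h : ι → A) : Prop :=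
  ∀ (S : Set ι) (i : ι), i ∉ S → ∀ a : A, a * h i ∈ Ideal.span (h '' S) → a ∈ Ideal.span (h '' S)

theorem mem_span_image_insert {A : Type*} [CommRing A] {h : ι → A} {S : Set ι} {i : ι} {x : A} :
    x ∈ Ideal.span (h '' insert i S) ↔ ∃ c, x - c * h i ∈ Ideal.span (h '' S) := by
  rw [Set.image_insert_eq, Ideal.mem_span_insert]
  constructor
  · rintro ⟨c, z, hz, rfl⟩
    exact ⟨c, by simpa using hz⟩
  · rintro ⟨c, hc⟩
    exact ⟨c, _, hc, by ring⟩

theorem homogeneousComponent_add_mul {a g : MvPolynomial σ k} {e : ℕ} (hg : g.IsHomogeneous e)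
    (s : ℕ) : homogeneousComponent (s + e) (a * g) = homogeneousComponent s a * g := by
  let _ := gradedAlgebra (σ := σ) (R := k)
  have := DirectSum.coe_decompose_mul_add_of_right_mem (homogeneousSubmodule σ k) (a := a)
    (b := g) (i := s) (j := e) hg
  rw [← decomposition.decompose'_apply, ← decomposition.decompose'_apply]
  exact this

theorem homogeneousComponent_mul_of_lt {a g : MvPolynomial σ k} {e s : ℕ}
    (hg : g.IsHomogeneous e) (hs : s < e) : homogeneousComponent s (a * g) = 0 := by
  let _ := gradedAlgebra (σ := σ) (R := k)
  have := DirectSum.coe_decompose_mul_of_right_mem_of_not_le (homogeneousSubmodule σ k) (a := a)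
    (b := g) (i := e) (n := s) hg (by omega)
  rw [← decomposition.decompose'_apply]
  exact this

variable {h : ι → MvPolynomial σ k} {e : ι → ℕ}

theorem homogeneousComponent_mem_span (hh : ∀ i, (h i).IsHomogeneous (e i)) {S : Set ι}
    {p : MvPolynomial σ k} (hp : p ∈ Ideal.span (h '' S)) (s : ℕ) :
    homogeneousComponent s p ∈ Ideal.span (h '' S) := by
  let _ := gradedAlgebra (σ := σ) (R := k)
  refine homogeneousComponent_mem_of_mem (Ideal.homogeneous_span _ _ ?_) hp s
  rintro _ ⟨i, -, rfl⟩
  exact ⟨e i, hh i⟩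

/-- In a homogeneous relation the cofactors can be chosen homogeneous. -/
theorem exists_homogeneous_cofactor (hh : ∀ i, (h i).IsHomogeneous (e i)) {S : Set ι} {i : ι}
    {s : ℕ} {x : MvPolynomial σ k} (hx : x.IsHomogeneous (s + e i))
    (hxS : x ∈ Ideal.span (h '' insert i S)) :
    ∃ c : MvPolynomial σ k, c.IsHomogeneous s ∧ x - c * h i ∈ Ideal.span (h '' S) := by
  obtain ⟨c, hc⟩ := mem_span_image_insert.1 hxS
  refine ⟨homogeneousComponent s c, homogeneousComponent_isHomogeneous _ _, ?_⟩
  have := homogeneousComponent_mem_span hh hc (s + e i)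
  rwa [map_sub, homogeneousComponent_add_mul (hh i), homogeneousComponent_eq_self hx] at this

theorem mem_span_of_degree_lt (hh : ∀ i, (h i).IsHomogeneous (e i)) {S : Set ι} {i : ι}
    {s : ℕ} {x : MvPolynomial σ k} (hx : x.IsHomogeneous s) (hs : s < e i)
    (hxS : x ∈ Ideal.span (h '' insert i S)) : x ∈ Ideal.span (h '' S) := by
  obtain ⟨c, hc⟩ := mem_span_image_insert.1 hxS
  have := homogeneousComponent_mem_span hh hc s
  rwa [map_sub, homogeneousComponent_mul_of_lt (hh i) hs, homogeneousComponent_eq_self hx,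
    sub_zero] at this

/-- Being a nonzerodivisor modulo a homogeneous ideal can be tested on homogeneous elements. -/
theorem regular_of_homogeneous (hh : ∀ i, (h i).IsHomogeneous (e i)) {S : Set ι}
    {g : MvPolynomial σ k} {d : ℕ} (hg : g.IsHomogeneous d)
    (H : ∀ s (a : MvPolynomial σ k), a.IsHomogeneous s → a * g ∈ Ideal.span (h '' S) →
      a ∈ Ideal.span (h '' S)) (a : MvPolynomial σ k) (ha : a * g ∈ Ideal.span (h '' S)) :
    a ∈ Ideal.span (h '' S) := by
  rw [← sum_homogeneousComponent a]
  refine Ideal.sum_mem _ fun s _ => H s _ (homogeneousComponent_isHomogeneous _ _) ?_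
  rw [← homogeneousComponent_add_mul hg]
  exact homogeneousComponent_mem_span hh ha _

/-- Permuting the last two members of a homogeneous regular sequence, by the graded Nakayama
lemma. -/
theorem regular_of_regular_insert (hh : ∀ i, (h i).IsHomogeneous (e i)) {S : Set ι} {j : ι}
    (hj : 0 < e j) {g : MvPolynomial σ k} {d : ℕ} (hg : g.IsHomogeneous d)
    (hjS : ∀ a, a * h j ∈ Ideal.span (h '' S) → a ∈ Ideal.span (h '' S))
    (hgS : ∀ a, a * g ∈ Ideal.span (h '' insert j S) → a ∈ Ideal.span (h '' insert j S)) :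
    ∀ a, a * g ∈ Ideal.span (h '' S) → a ∈ Ideal.span (h '' S) := by
  refine regular_of_homogeneous hh hg fun s => ?_
  induction s using Nat.strong_induction_on with
  | _ s ih =>
    intro a ha hag
    have ha' := hgS a
      (Ideal.span_mono (Set.image_mono (Set.subset_insert _ _)) hag)
    rcases lt_or_ge s (e j) with hs | hs
    · exact mem_span_of_degree_lt hh ha hs ha'
    · obtain ⟨c, hc, hac⟩ := exists_homogeneous_cofactor hh (i := j) (s := s - e j) (x := a)
        (by rwa [Nat.sub_add_cancel hs]) ha'
      have hcg : c * g * h j ∈ Ideal.span (h '' S) := by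
        have := Ideal.sub_mem _ hag (Ideal.mul_mem_right g _ hac)
        convert this using 1
        ring
      have := ih (s - e j) (by omega) c hc (hjS _ hcg)
      have := Ideal.add_mem _ hac (Ideal.mul_mem_right (h j) _ this)
      simpa using this

/-- Exchange: a homogeneous member of a permutably regular family may be replaced by any
homogeneous element of positive degree that is regular modulo all the other members. -/
theorem IsPermRegular.exchange [Finite ι] [DecidableEq ι]
    (hh : ∀ i, (h i).IsHomogeneous (e i)) (he : ∀ i, 0 < e i) {i₀ : ι} {l : MvPolynomial σ k}
    (hl : IsPermRegular (Function.update h i₀ l))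
    (hreg : ∀ a, a * h i₀ ∈ Ideal.span (h '' {i₀}ᶜ) → a ∈ Ideal.span (h '' {i₀}ᶜ)) :
    IsPermRegular h := by
  have hS : ∀ S : Set ι, i₀ ∉ S → Function.update h i₀ l '' S = h '' S := fun S hS =>
    Set.image_congr fun j hj => Function.update_of_ne (by rintro rfl; exact hS hj) _ _
  have hother : ∀ (S : Set ι) (i : ι), i ∉ S → i₀ ∉ S → i ≠ i₀ → ∀ a,
      a * h i ∈ Ideal.span (h '' S) → a ∈ Ideal.span (h '' S) := by
    intro S i hiS h0 hi a ha
    have := hl S i hiS a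
    rw [hS S h0, Function.update_of_ne hi] at this
    exact this ha
  have hzero : ∀ (T : Set ι), T.Finite → i₀ ∉ T → ∀ a,
      a * h i₀ ∈ Ideal.span (h '' ({i₀}ᶜ \ T)) → a ∈ Ideal.span (h '' ({i₀}ᶜ \ T)) := by
    intro T hT
    induction T, hT using Set.Finite.induction_on with
    | empty => intro _; simpa using hreg
    | @insert j T hj _ ih =>
      intro h0
      have hj0 : j ≠ i₀ := by rintro rfl; exact h0 (Set.mem_insert _ _)
      refine regular_of_regular_insert hh (he j) (hh i₀) (hother _ j ?_ ?_ hj0) ?_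
      · simp
      · simp
      · have : insert j ({i₀}ᶜ \ insert j T) = {i₀}ᶜ \ T := by
          ext x
          simp only [Set.mem_insert_iff, Set.mem_sdiff, Set.mem_compl_iff, Set.mem_singleton_iff]
          constructor
          · rintro (rfl | ⟨h1, h2⟩)
            · exact ⟨hj0, hj⟩
            · exact ⟨h1, fun h => h2 (Or.inr h)⟩
          · rintro ⟨h1, h2⟩
            by_cases hx : x = j
            · exact Or.inl hx
            · exact Or.inr ⟨h1, by simp [hx, h2]⟩
        rw [this]
        exact ih fun h => h0 (Set.mem_insert_of_mem _ h)
  have hzero' : ∀ S : Set ι, i₀ ∉ S → ∀ a, a * h i₀ ∈ Ideal.span (h '' S) →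
      a ∈ Ideal.span (h '' S) := by
    intro S hS0
    have := hzero ({i₀}ᶜ \ S) (Set.toFinite _) (by simp)
    rwa [sdiff_sdiff_right_self, inf_eq_right.2] at this
    exact fun x hx hx0 => hS0 (hx0 ▸ hx)
  intro S i hiS a ha
  by_cases hi : i = i₀
  · subst hi
    exact hzero' S hiS a ha
  by_cases h0 : i₀ ∈ S
  · obtain ⟨S', hS', rfl⟩ : ∃ S', i₀ ∉ S' ∧ insert i₀ S' = S :=
      ⟨S \ {i₀}, by simp, by simp [Set.insert_eq_of_mem h0]⟩
    have hiS' : i ∉ S' := fun h => hiS (Set.mem_insert_of_mem _ h)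
    obtain ⟨b, hb⟩ := mem_span_image_insert.1 ha
    -- `a hᵢ ≡ b h₀` makes `b` a multiple of `hᵢ`, because `h₀` is regular modulo `S'` and `hᵢ`.
    have hb' : b ∈ Ideal.span (h '' insert i S') := by
      refine hzero' _ (by simp [hS', Ne.symm hi]) b (mem_span_image_insert.2 ⟨a, ?_⟩)
      have := Ideal.neg_mem_iff _ |>.2 hb
      simpa using this
    obtain ⟨c, hc⟩ := mem_span_image_insert.1 hb'
    refine mem_span_image_insert.2 ⟨c, hother S' i hiS' hS' hi _ ?_⟩
    have := Ideal.add_mem _ hb (Ideal.mul_mem_right (h i₀) _ hc)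
    convert this using 1
    ring
  · exact hother S i hiS h0 hi a ha

/-- The numerical criterion for regularity: let `l` be a linear form that is regular modulo a
homogeneous ideal `J`. If `J + (l)` and `J + (g)` contain all forms of large degree, then the
Hilbert function of `R/J` is eventually constant, so multiplication by `g` is bijective in large
degrees, and hence `g` is regular modulo `J`. -/
theorem regular_of_eventually_surjective [Finite σ] {J : Ideal (MvPolynomial σ k)}
    {l g : MvPolynomial σ k} {d : ℕ} (hl : l.IsHomogeneous 1) (hg : g.IsHomogeneous d)
    (hlJ : ∀ a, a * l ∈ J → a ∈ J) (s₀ : ℕ)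
    (hls : ∀ s ≥ s₀, ∀ p : MvPolynomial σ k, p.IsHomogeneous (s + 1) →
      ∃ c : MvPolynomial σ k, c.IsHomogeneous s ∧ p - c * l ∈ J)
    (hgs : ∀ s ≥ s₀, ∀ p : MvPolynomial σ k, p.IsHomogeneous (s + d) →
      ∃ c : MvPolynomial σ k, c.IsHomogeneous s ∧ p - c * g ∈ J)
    {s : ℕ} {a : MvPolynomial σ k} (ha : a.IsHomogeneous s) (hag : a * g ∈ J) : a ∈ J := by
  let A := MvPolynomial σ k ⧸ J
  let π : MvPolynomial σ k →ₐ[k] A := Ideal.Quotient.mkₐ k J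
  have hπ : ∀ p, π p = 0 ↔ p ∈ J := fun p => Ideal.Quotient.eq_zero_iff_mem
  let Q : ℕ → Submodule k A := fun s => (homogeneousSubmodule σ k s).map π.toLinearMap
  have hQ : ∀ s, FiniteDimensional k (Q s) := fun s =>
    Module.Finite.iff_fg.2 ((homogeneousSubmodule_fg σ k s).map _)
  have hmap : ∀ (f : MvPolynomial σ k) (m : ℕ), f.IsHomogeneous m →
      (∀ s ≥ s₀, ∀ p : MvPolynomial σ k, p.IsHomogeneous (s + m) →
      ∃ c : MvPolynomial σ k, c.IsHomogeneous s ∧ p - c * f ∈ J) →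
      ∀ s ≥ s₀, (Q s).map (LinearMap.mulRight k (π f)) = Q (s + m) := by
    intro f m hf hfs s hs
    apply le_antisymm
    · rintro _ ⟨_, ⟨p, hp, rfl⟩, rfl⟩
      exact ⟨p * f, hp.mul hf, by simp⟩
    · rintro _ ⟨p, hp, rfl⟩
      obtain ⟨c, hc, hpc⟩ := hfs s hs p hp
      refine ⟨π c, ⟨c, hc, rfl⟩, ?_⟩
      have := (hπ _).2 hpc
      rw [map_sub, map_mul, sub_eq_zero] at this
      simpa using this.symm
  have hinj : Function.Injective (LinearMap.mulRight k (π l)) := by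
    rw [injective_iff_map_eq_zero]
    intro x hx
    obtain ⟨p, rfl⟩ := Ideal.Quotient.mkₐ_surjective k J x
    exact (hπ p).2 (hlJ p ((hπ _).1 (by rw [map_mul]; exact hx)))
  have hrank : ∀ m, ∀ s ≥ s₀, Module.finrank k (Q (s + m)) = Module.finrank k (Q s) := by
    intro m s hs
    induction m with
    | zero => rfl
    | succ m ih =>
      rw [← ih, ← add_assoc, ← hmap l 1 hl hls (s + m) (by omega)]
      exact (Submodule.equivMapOfInjective _ hinj _).finrank_eq.symm
  have hinjg : ∀ s ≥ s₀, ∀ x ∈ Q s, x * π g = 0 → x = 0 := by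
    intro s hs x hx hxg
    let φ : Q s →ₗ[k] Q (s + d) := ((LinearMap.mulRight k (π g)).domRestrict (Q s)).codRestrict _
      fun y => by
        rw [← hmap g d hg hgs s hs]
        exact ⟨y, y.2, rfl⟩
    have hsurj : Function.Surjective φ := by
      rintro ⟨y, hy⟩
      obtain ⟨z, hz, rfl⟩ : y ∈ (Q s).map (LinearMap.mulRight k (π g)) := by
        rwa [hmap g d hg hgs s hs]
      exact ⟨⟨z, hz⟩, rfl⟩
    have hφ := (LinearMap.injective_iff_surjective_of_finrank_eq_finrank
      (hrank d s hs).symm (f := φ)).2 hsurj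
    have : (⟨x, hx⟩ : Q s) = 0 := hφ (by
      rw [map_zero]
      exact Subtype.ext hxg)
    exact congrArg Subtype.val this
  -- Multiplication by a power of `l` moves `a` into the degrees where `g` acts injectively.
  have h1 : π (a * l ^ s₀) = 0 := by
    refine hinjg (s + s₀) (by omega) _ ⟨_, ha.mul ?_, rfl⟩ ?_
    · simpa using hl.pow s₀
    · rw [← map_mul, hπ]
      convert J.mul_mem_right (l ^ s₀) hag using 1
      ring
  have h2 : ∀ m, π (a * l ^ m) = 0 → π a = 0 := by
    intro m
    induction m with
    | zero => simp
    | succ m ih =>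
      intro h
      refine ih (hinj ?_)
      rw [map_zero, LinearMap.mulRight_apply, ← map_mul, ← h]
      congr 1
      ring
  exact (hπ a).1 (h2 s₀ h1)

end Regular

/-! ### Forms without a common zero -/

section Zeros

variable {σ ι k : Type*} [Field k]

/-- The only common zero of the polynomials `h i` in affine space is the origin; for forms this says
that they have no common zero in projective space. -/
def HasOnlyTrivialZero (h : ι → MvPolynomial σ k) : Prop :=
  ∀ v : σ → k, (∀ i, eval v (h i) = 0) → v = 0

/-- The polynomials of total degree `< s`. In contrast to `MvPolynomial.restrictTotalDegree`, the
value at `s = 0` is the zero space. -/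
noncomputable abbrev degreeLT (k σ : Type*) [Field k] (s : ℕ) : Submodule k (MvPolynomial σ k) :=
  restrictSupport k {α : σ →₀ ℕ | α.degree < s}

theorem finite_setOf_degree_lt (σ : Type*) [Finite σ] (s : ℕ) :
    {α : σ →₀ ℕ | α.degree < s}.Finite :=
  (Finsupp.finite_of_degree_le (σ := σ) s).subset fun α (h : α.degree < s) => h.le

theorem mem_degreeLT_of_isHomogeneous {p : MvPolynomial σ k} {s m : ℕ} (hp : p.IsHomogeneous s)
    (hs : s < m) : p ∈ degreeLT k σ m := by
  intro α hα
  have : α.degree = s := by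
    by_contra hne
    exact (Finsupp.mem_support_iff.1 hα) (hp.coeff_eq_zero hne)
  simpa [this] using hs

theorem exists_mem_degreeLT (p : MvPolynomial σ k) : ∃ m, p ∈ degreeLT k σ m := by
  refine ⟨p.support.sup Finsupp.degree + 1, fun α hα => ?_⟩
  exact Nat.lt_succ_of_le (Finset.le_sup (f := Finsupp.degree) hα)

/-- If every monomial of degree at least `s₀` is congruent to a polynomial of smaller degree, then
every polynomial is congruent to one of degree less than `s₀`. -/
theorem sup_degreeLT_eq_top {J : Ideal (MvPolynomial σ k)} {s₀ : ℕ}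
    (H : ∀ α : σ →₀ ℕ, s₀ ≤ α.degree →
      monomial α (1 : k) ∈ J.restrictScalars k ⊔ degreeLT k σ α.degree) :
    J.restrictScalars k ⊔ degreeLT k σ s₀ = ⊤ := by
  have key : ∀ m, degreeLT k σ m ≤ J.restrictScalars k ⊔ degreeLT k σ s₀ := by
    intro m
    induction m with
    | zero => simp [degreeLT, restrictSupport_eq_span]
    | succ m ih =>
      rw [degreeLT, restrictSupport_eq_span, Submodule.span_le]
      rintro _ ⟨α, hα, rfl⟩
      rcases lt_or_ge α.degree s₀ with h | h
      · exact Submodule.mem_sup_right (by simpa using h)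
      · refine (sup_le le_sup_left (le_trans (restrictSupport_mono _ ?_) ih)) (H α h)
        intro β (hβ : β.degree < α.degree)
        have : α.degree < m + 1 := hα
        show β.degree < m
        omega
  refine eq_top_iff.2 fun p _ => ?_
  obtain ⟨m, hm⟩ := exists_mem_degreeLT p
  exact key m hm

theorem mk_domRestrict_surjective {J : Ideal (MvPolynomial σ k)}
    {W : Submodule k (MvPolynomial σ k)} (H : J.restrictScalars k ⊔ W = ⊤) :
    Function.Surjective ((Ideal.Quotient.mkₐ k J).toLinearMap.domRestrict W) := by
  intro x
  obtain ⟨p, rfl⟩ := Ideal.Quotient.mkₐ_surjective k J x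
  obtain ⟨a, ha, b, hb, rfl⟩ := Submodule.mem_sup.1 (H ▸ Submodule.mem_top : p ∈ _)
  refine ⟨⟨b, hb⟩, ?_⟩
  have : Ideal.Quotient.mk J a = 0 := Ideal.Quotient.eq_zero_iff_mem.2 ha
  simp [this]

theorem finite_quotient_of_sup_degreeLT [Finite σ] {J : Ideal (MvPolynomial σ k)} {s₀ : ℕ}
    (H : J.restrictScalars k ⊔ degreeLT k σ s₀ = ⊤) :
    Module.Finite k (MvPolynomial σ k ⧸ J) := by
  have : Finite {α : σ →₀ ℕ | α.degree < s₀} := finite_setOf_degree_lt σ s₀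
  have : Module.Finite k (degreeLT k σ s₀) := Module.Finite.of_basis (basisRestrictSupport k _)
  exact Module.Finite.of_surjective _ (mk_domRestrict_surjective H)

/-- An ideal with a finite-dimensional quotient algebra has finitely many zeros. -/
theorem finite_zeros_of_finite_quotient (J : Ideal (MvPolynomial σ k))
    [Module.Finite k (MvPolynomial σ k ⧸ J)] :
    {v : σ → k | ∀ p ∈ J, eval v p = 0}.Finite := by
  let F : {v : σ → k | ∀ p ∈ J, eval v p = 0} → ((MvPolynomial σ k ⧸ J) →ₐ[k] k) := fun v =>
    Ideal.Quotient.liftₐ J (aeval v.1) fun p hp => v.2 p hp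
  have hF : Function.Injective F := by
    intro v w hvw
    ext i
    have := DFunLike.congr_fun hvw (Ideal.Quotient.mk J (X i))
    change aeval v.1 (X i) = aeval w.1 (X i) at this
    simpa using this
  exact Set.finite_coe_iff.1 (Finite.of_injective F hF)

/-- By the Nullstellensatz, forms without a nontrivial common zero generate an ideal that contains
all forms of large degree. -/
theorem HasOnlyTrivialZero.exists_mem_span [Finite σ] [IsAlgClosed k]
    {h : ι → MvPolynomial σ k} (hz : HasOnlyTrivialZero h) :
    ∃ s₀, ∀ s ≥ s₀, ∀ p : MvPolynomial σ k, p.IsHomogeneous s → p ∈ Ideal.span (Set.range h) := by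
  have hrad : idealOfVars σ k ≤ (Ideal.span (Set.range h)).radical := by
    rw [← vanishingIdeal_zeroLocus_eq_radical (K := k), idealOfVars, Ideal.span_le]
    rintro _ ⟨i, rfl⟩
    intro v hv
    have : v = 0 := hz v fun i => hv _ (Ideal.subset_span ⟨i, rfl⟩)
    simp [this]
  obtain ⟨s₀, hs₀⟩ := Ideal.exists_pow_le_of_le_radical_of_fg hrad (idealOfVars_fg σ k)
  refine ⟨s₀, fun s hs p hp => hs₀ ?_⟩
  rw [mem_pow_idealOfVars_iff']
  exact fun x hx => hp.coeff_eq_zero (by omega)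

variable {h : ι → MvPolynomial σ k} {e : ι → ℕ}

/-- In a family of forms without a nontrivial common zero, any one member can be replaced by a
linear form: the others vanish on finitely many lines only. -/
theorem HasOnlyTrivialZero.exists_linear [Fintype σ] [IsAlgClosed k] [DecidableEq ι]
    (hh : ∀ i, (h i).IsHomogeneous (e i)) (he : ∀ i, 0 < e i) (hz : HasOnlyTrivialZero h)
    (i₀ : ι) :
    ∃ l : MvPolynomial σ k, l.IsHomogeneous 1 ∧ HasOnlyTrivialZero (Function.update h i₀ l) := by
  -- Each line in the common zero set of the other members meets `h i₀ = 1`.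
  let J : Ideal (MvPolynomial σ k) := Ideal.span (h '' {i₀}ᶜ) ⊔ Ideal.span {h i₀ - 1}
  obtain ⟨s₀, hs₀⟩ := hz.exists_mem_span
  have hJ : J.restrictScalars k ⊔ degreeLT k σ (s₀ + e i₀) = ⊤ := by
    refine sup_degreeLT_eq_top fun α hα => ?_
    have hα' := hs₀ α.degree (by omega) (monomial α 1) (isHomogeneous_monomial _ rfl)
    have hr : Set.range h = h '' insert i₀ {i₀}ᶜ := by
      rw [← Set.image_univ]
      congr 1
      ext i
      simp [em]
    rw [hr] at hα'
    obtain ⟨c, hc, hac⟩ := exists_homogeneous_cofactor hh (i := i₀) (s := α.degree - e i₀)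
      (isHomogeneous_monomial _ (by omega)) hα'
    have : monomial α (1 : k) = ((monomial α 1 - c * h i₀) + c * (h i₀ - 1)) + c := by ring
    rw [this]
    refine Submodule.add_mem_sup ?_ (mem_degreeLT_of_isHomogeneous hc ?_)
    · exact J.add_mem (Ideal.mem_sup_left hac)
        (Ideal.mem_sup_right (Ideal.mul_mem_left _ _ (Ideal.mem_span_singleton_self _)))
    · have := he i₀
      omega
  have := finite_quotient_of_sup_degreeLT hJ
  have hfin := finite_zeros_of_finite_quotient J
  have : Finite {v : σ → k | ∀ p ∈ J, eval v p = 0} := hfin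
  have h0 : ∀ i (v : σ → k) (c : k), eval (c • v) (h i) = c ^ e i * eval v (h i) := by
    intro i v c
    rw [eval_eq, eval_eq, Finset.mul_sum]
    refine Finset.sum_congr rfl fun α hα => ?_
    have hs : ∑ j ∈ α.support, α j = e i := by
      have := hh i (mem_support_iff.1 hα)
      simpa [Finsupp.weight_apply, Finsupp.sum] using this
    simp only [Pi.smul_apply, smul_eq_mul, mul_pow, Finset.prod_mul_distrib,
      Finset.prod_pow_eq_pow_sum, hs]
    ring
  obtain ⟨f, hf⟩ := Module.exists_dual_forall_apply_ne_zero (K := k)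
    (fun v : {v : σ → k | ∀ p ∈ J, eval v p = 0} => v.1) (by
      rintro ⟨v, hv⟩ (rfl : v = 0)
      have h1 := hv _ (Ideal.mem_sup_right (Ideal.mem_span_singleton_self _))
      have h2 := h0 i₀ 0 0
      rw [zero_pow (he i₀).ne', zero_mul, smul_zero] at h2
      rw [map_sub, h2, map_one, zero_sub] at h1
      exact one_ne_zero (neg_eq_zero.1 h1))
  classical
  let l : MvPolynomial σ k := ∑ i, C (f (Pi.single i 1)) * X i
  have hl : ∀ v, eval v l = f v := by
    intro v
    conv_rhs => rw [LinearMap.pi_apply_eq_sum_univ f v]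
    simp only [l, map_sum, map_mul, eval_C, eval_X, smul_eq_mul]
    refine Finset.sum_congr rfl fun i _ => ?_
    rw [mul_comm]
    congr 2
    ext j
    simp [Pi.single_apply, eq_comm]
  refine ⟨l, IsHomogeneous.sum _ _ _ fun i _ => isHomogeneous_C_mul_X _ _, fun v hv => ?_⟩
  have hvl : f v = 0 := by
    have := hv i₀
    rwa [Function.update_self, hl] at this
  have hvj : ∀ j, j ≠ i₀ → eval v (h j) = 0 := by
    intro j hj
    have := hv j
    rwa [Function.update_of_ne hj] at this
  by_cases hvi : eval v (h i₀) = 0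
  · exact hz v fun j => if hj : j = i₀ then hj ▸ hvi else hvj j hj
  · exfalso
    obtain ⟨c, hc⟩ := IsAlgClosed.exists_pow_nat_eq (eval v (h i₀))⁻¹ (he i₀)
    refine hf ⟨c • v, ?_⟩ (by simp [hvl])
    intro p hp
    have hle : J ≤ RingHom.ker (eval (c • v)) := by
      refine sup_le (Ideal.span_le.2 ?_) ?_
      · rintro _ ⟨j, hj, rfl⟩
        simp [RingHom.mem_ker, h0, hvj j hj]
      · rw [Ideal.span_singleton_le_iff_mem, RingHom.mem_ker, map_sub, h0, hc, map_one,
          inv_mul_cancel₀ hvi, sub_self]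
    exact hle hp

theorem isPermRegular_X : IsPermRegular (X : σ → MvPolynomial σ k) := by
  intro S i hi a ha
  rw [mem_ideal_span_X_image] at ha ⊢
  intro m hm
  obtain ⟨j, hj, hmj⟩ := ha (m + Finsupp.single i 1) (by
    rw [mem_support_iff, coeff_mul_X]
    exact mem_support_iff.1 hm)
  refine ⟨j, hj, ?_⟩
  have : i ≠ j := by rintro rfl; exact hi hj
  simpa [Finsupp.single_apply, this] using hmj

theorem IsPermRegular.map {A B : Type*} [CommRing A] [CommRing B] {h : ι → A}
    (hr : IsPermRegular h) (φ : A ≃+* B) : IsPermRegular fun i => φ (h i) := by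
  intro S i hi b hb
  have hS : Ideal.span ((fun i => φ (h i)) '' S) = (Ideal.span (h '' S)).map φ := by
    rw [Ideal.map_span, Set.image_image]
  have hmem : ∀ x : A, φ x ∈ (Ideal.span (h '' S)).map φ ↔ x ∈ Ideal.span (h '' S) := by
    intro x
    rw [Ideal.mem_map_of_equiv]
    exact ⟨fun ⟨y, hy, hxy⟩ => φ.injective hxy ▸ hy, fun hx => ⟨x, hx, rfl⟩⟩
  obtain ⟨a, rfl⟩ := φ.surjective b
  rw [hS] at hb ⊢
  rw [← map_mul, hmem] at hb
  exact (hmem a).2 (hr S i hi a hb)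

/-- Linear forms without a nontrivial common zero are the images of the variables under a linear
change of coordinates. -/
theorem isPermRegular_of_linear [Fintype σ] {h : σ → MvPolynomial σ k}
    (hh : ∀ i, (h i).IsHomogeneous 1) (hz : HasOnlyTrivialZero h) : IsPermRegular h := by
  classical
  have hex : ∀ i, ∃ c : σ → k, ∑ j, c j • (X j : MvPolynomial σ k) = h i := by
    intro i
    have := (mem_homogeneousSubmodule 1 (h i)).2 (hh i)
    rw [homogeneousSubmodule_one_eq_span_X] at this
    exact (Submodule.mem_span_range_iff_exists_fun k).1 this
  choose M hM using hex
  let A : Matrix σ σ k := Matrix.of M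
  have hA : IsUnit A := by
    rw [← Matrix.mulVec_injective_iff_isUnit]
    rw [← Matrix.coe_mulVecLin, injective_iff_map_eq_zero]
    intro v hv
    refine hz v fun i => ?_
    rw [← hM i]
    have := congrFun hv i
    simpa [Matrix.mulVec, dotProduct, A, smul_eval] using this
  have hdet : IsUnit A.det := (Matrix.isUnit_iff_isUnit_det A).1 hA
  have hcomp : ∀ (P Q : Matrix σ σ k), P * Q = 1 → ∀ i,
      ∑ j, P i j • ∑ l, Q j l • (X l : MvPolynomial σ k) = X i := by
    intro P Q hPQ i
    simp only [Finset.smul_sum, smul_smul]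
    rw [Finset.sum_comm]
    simp only [← Finset.sum_smul]
    simp only [← Matrix.mul_apply, hPQ]
    simp [Matrix.one_apply]
  let φ : MvPolynomial σ k ≃ₐ[k] MvPolynomial σ k := AlgEquiv.ofAlgHom (aeval h)
    (aeval fun i => ∑ j, A⁻¹ i j • X j)
    (by
      ext1 i
      simp only [AlgHom.comp_apply, aeval_X, map_sum, map_smul, AlgHom.id_apply, ← hM]
      exact hcomp A⁻¹ A (Matrix.nonsing_inv_mul A hdet) i)
    (by
      ext1 i
      simp only [AlgHom.comp_apply, aeval_X, map_sum, map_smul, AlgHom.id_apply, ← hM]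
      exact hcomp A A⁻¹ (Matrix.mul_nonsing_inv A hdet) i)
  have := (isPermRegular_X (k := k) (σ := σ)).map φ.toRingEquiv
  convert this using 2 with i
  simp [φ]

end Zeros

section Koszul

variable {σ k : Type*} [Field k]

/-- Square systems of forms of positive degrees without a nontrivial common zero are regular
sequences. The induction replaces the members by linear forms one at a time. -/
theorem HasOnlyTrivialZero.isPermRegular [Fintype σ] [IsAlgClosed k] {h : σ → MvPolynomial σ k}
    {e : σ → ℕ} (hh : ∀ i, (h i).IsHomogeneous (e i)) (he : ∀ i, 0 < e i)
    (hz : HasOnlyTrivialZero h) : IsPermRegular h := by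
  classical
  induction hm : (Finset.univ.filter fun i => e i ≠ 1).card generalizing h e with
  | zero =>
    rw [Finset.card_eq_zero, Finset.filter_eq_empty_iff] at hm
    refine isPermRegular_of_linear (fun i => ?_) hz
    have : e i = 1 := not_not.1 (hm (Finset.mem_univ i))
    exact this ▸ hh i
  | succ m ih =>
    obtain ⟨i₀, hi₀⟩ : (Finset.univ.filter fun i => e i ≠ 1).Nonempty := by
      rw [← Finset.card_pos]
      omega
    obtain ⟨l, hl, hzl⟩ := hz.exists_linear hh he i₀
    have hhl : ∀ i, (Function.update h i₀ l i).IsHomogeneous (Function.update e i₀ 1 i) := by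
      intro i
      by_cases hi : i = i₀
      · subst hi
        simpa using hl
      · simpa [hi] using hh i
    have hl' : IsPermRegular (Function.update h i₀ l) := by
      refine ih hhl (fun i => ?_) hzl ?_
      · by_cases hi : i = i₀
        · subst hi
          simp
        · simpa [hi] using he i
      · have : (Finset.univ.filter fun i => Function.update e i₀ 1 i ≠ 1) =
            (Finset.univ.filter fun i => e i ≠ 1).erase i₀ := by
          ext i
          by_cases hi : i = i₀
          · subst hi
            simp
          · simp [hi]
        rw [this, Finset.card_erase_of_mem hi₀, hm]
        rfl
    have hJ : Function.update h i₀ l '' {i₀}ᶜ = h '' {i₀}ᶜ :=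
      Set.image_congr fun j hj => Function.update_of_ne hj _ _
    have hr : ∀ g : σ → MvPolynomial σ k, Set.range g = g '' insert i₀ {i₀}ᶜ := by
      intro g
      rw [← Set.image_univ]
      congr 1
      ext i
      simp [em]
    refine IsPermRegular.exchange hh he hl' (regular_of_homogeneous hh (hh i₀) ?_)
    intro s a ha hag
    obtain ⟨s₁, hs₁⟩ := hzl.exists_mem_span
    obtain ⟨s₂, hs₂⟩ := hz.exists_mem_span
    refine regular_of_eventually_surjective hl (hh i₀) ?_ (max s₁ s₂) ?_ ?_ ha hag
    · intro b hb
      have := hl' {i₀}ᶜ i₀ (by simp) b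
      rw [hJ, Function.update_self] at this
      exact this hb
    · intro s hs p hp
      have := exists_homogeneous_cofactor hhl (i := i₀) (S := {i₀}ᶜ) (s := s) (x := p)
        (by simpa using hp) (by rw [← hr]; exact hs₁ _ (by omega) p hp)
      rwa [hJ, Function.update_self] at this
    · intro s hs p hp
      exact exists_homogeneous_cofactor hh (by simpa using hp)
        (by rw [← hr]; exact hs₂ _ (by omega) p hp)

/-! ### Hilbert functions -/

/-- The forms of degree `s` in the ideal `J`. -/
noncomputable def formsIn (J : Ideal (MvPolynomial σ k)) (s : ℕ) :
    Submodule k (MvPolynomial σ k) :=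
  J.restrictScalars k ⊓ homogeneousSubmodule σ k s

theorem mem_formsIn {J : Ideal (MvPolynomial σ k)} {s : ℕ} {p : MvPolynomial σ k} :
    p ∈ formsIn J s ↔ p ∈ J ∧ p.IsHomogeneous s := Iff.rfl

instance [Finite σ] (s : ℕ) : FiniteDimensional k (homogeneousSubmodule σ k s) :=
  Module.Finite.iff_fg.2 (homogeneousSubmodule_fg σ k s)

instance [Finite σ] (J : Ideal (MvPolynomial σ k)) (s : ℕ) : FiniteDimensional k (formsIn J s) :=
  Submodule.finiteDimensional_of_le (inf_le_right : _ ≤ homogeneousSubmodule σ k s)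

variable {ι : Type*} {h : ι → MvPolynomial σ k} {e : ι → ℕ}

theorem formsIn_insert_of_lt (hh : ∀ i, (h i).IsHomogeneous (e i)) {S : Set ι} {i : ι} {s : ℕ}
    (hs : s < e i) :
    formsIn (Ideal.span (h '' insert i S)) s = formsIn (Ideal.span (h '' S)) s := by
  ext p
  simp only [mem_formsIn]
  exact ⟨fun ⟨h1, h2⟩ => ⟨mem_span_of_degree_lt hh h2 hs h1, h2⟩,
    fun ⟨h1, h2⟩ => ⟨Ideal.span_mono (Set.image_mono (Set.subset_insert _ _)) h1, h2⟩⟩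

/-- The recursion for Hilbert functions along a regular sequence. -/
theorem IsPermRegular.finrank_formsIn_insert [Finite σ] (hh : ∀ i, (h i).IsHomogeneous (e i))
    (hr : IsPermRegular h) {S : Set ι} {i : ι} (hi : i ∉ S) (s : ℕ) :
    Module.finrank k (formsIn (Ideal.span (h '' insert i S)) (s + e i)) +
        Module.finrank k (formsIn (Ideal.span (h '' S)) s) =
      Module.finrank k (formsIn (Ideal.span (h '' S)) (s + e i)) +
        Module.finrank k (homogeneousSubmodule σ k s) := by
  let μ : MvPolynomial σ k →ₗ[k] MvPolynomial σ k := LinearMap.mulRight k (h i)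
  have hμ : Function.Injective μ := by
    rw [injective_iff_map_eq_zero]
    intro a ha
    have := hr ∅ i (by simp) a
    simp only [Set.image_empty, Ideal.span_empty, Ideal.mem_bot] at this
    exact this ha
  have hsup : formsIn (Ideal.span (h '' S)) (s + e i) ⊔ (homogeneousSubmodule σ k s).map μ =
      formsIn (Ideal.span (h '' insert i S)) (s + e i) := by
    apply le_antisymm
    · refine sup_le (fun p hp => ?_) ?_
      · exact ⟨Ideal.span_mono (Set.image_mono (Set.subset_insert _ _)) hp.1, hp.2⟩
      · rintro _ ⟨p, hp, rfl⟩
        exact ⟨Ideal.mul_mem_left _ _ (Ideal.subset_span ⟨i, Set.mem_insert _ _, rfl⟩),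
          IsHomogeneous.mul hp (hh i)⟩
    · intro p hp
      obtain ⟨c, hc, hpc⟩ := exists_homogeneous_cofactor hh hp.2 hp.1
      have : p = (p - c * h i) + μ c := by simp [μ]
      rw [this]
      exact Submodule.add_mem_sup ⟨hpc, IsHomogeneous.sub hp.2 (hc.mul (hh i))⟩ ⟨c, hc, rfl⟩
  have hinf : formsIn (Ideal.span (h '' S)) (s + e i) ⊓ (homogeneousSubmodule σ k s).map μ =
      (formsIn (Ideal.span (h '' S)) s).map μ := by
    apply le_antisymm
    · rintro _ ⟨hp, a, ha, rfl⟩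
      exact ⟨a, ⟨hr S i hi a hp.1, ha⟩, rfl⟩
    · rintro _ ⟨a, ha, rfl⟩
      exact ⟨⟨Ideal.mul_mem_right _ _ ha.1, IsHomogeneous.mul ha.2 (hh i)⟩, a, ha.2, rfl⟩
  have := Submodule.finrank_sup_add_finrank_inf_eq (formsIn (Ideal.span (h '' S)) (s + e i))
    ((homogeneousSubmodule σ k s).map μ)
  rw [hsup, hinf] at this
  rw [(Submodule.equivMapOfInjective μ hμ (homogeneousSubmodule σ k s)).finrank_eq,
    (Submodule.equivMapOfInjective μ hμ (formsIn (Ideal.span (h '' S)) s)).finrank_eq]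
  exact this

/-- The Hilbert function of a complete intersection depends only on the degrees. -/
theorem IsPermRegular.finrank_formsIn_eq [Finite σ] [Finite ι]
    {h' : ι → MvPolynomial σ k} (hh : ∀ i, (h i).IsHomogeneous (e i))
    (hh' : ∀ i, (h' i).IsHomogeneous (e i)) (hr : IsPermRegular h) (hr' : IsPermRegular h')
    (S : Set ι) (s : ℕ) :
    Module.finrank k (formsIn (Ideal.span (h '' S)) s) =
      Module.finrank k (formsIn (Ideal.span (h' '' S)) s) := by
  induction S, S.toFinite using Set.Finite.induction_on generalizing s with
  | empty => rw [Set.image_empty, Set.image_empty]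
  | @insert i S hi _ ih =>
    rcases lt_or_ge s (e i) with hs | hs
    · rw [formsIn_insert_of_lt hh hs, formsIn_insert_of_lt hh' hs, ih]
    · obtain ⟨s, rfl⟩ := Nat.exists_eq_add_of_le' hs
      have h1 := hr.finrank_formsIn_insert hh hi s
      have h2 := hr'.finrank_formsIn_insert hh' hi s
      rw [ih, ih] at h1
      omega

theorem finrank_restrictSupport (T : Set (σ →₀ ℕ)) :
    Module.finrank k (restrictSupport k T) = Nat.card T :=
  Module.finrank_eq_nat_card_basis (basisRestrictSupport k T)

theorem formsIn_span_X_pow (e : σ → ℕ) (S : Set σ) (s : ℕ) :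
    formsIn (Ideal.span ((fun i => (X i : MvPolynomial σ k) ^ e i) '' S)) s =
      restrictSupport k {α : σ →₀ ℕ | α.degree = s ∧ ∃ i ∈ S, e i ≤ α i} := by
  have hS : (fun i => (X i : MvPolynomial σ k) ^ e i) '' S =
      (fun α => monomial α (1 : k)) '' ((fun i => Finsupp.single i (e i)) '' S) := by
    rw [Set.image_image]
    simp [X_pow_eq_monomial]
  ext p
  rw [mem_formsIn, hS, mem_ideal_span_monomial_image, mem_restrictSupport_iff,
    ← mem_homogeneousSubmodule, homogeneousSubmodule_eq_finsupp_supported]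
  constructor
  · rintro ⟨h1, h2⟩ α hα
    obtain ⟨_, ⟨i, hi, rfl⟩, hle⟩ := h1 α hα
    exact ⟨h2 hα, i, hi, by simpa using hle⟩
  · intro H
    refine ⟨fun α hα => ?_, fun α hα => (H hα).1⟩
    obtain ⟨-, i, hi, hle⟩ := H hα
    exact ⟨_, ⟨i, hi, rfl⟩, by simpa using hle⟩

/-- The Hilbert function of a part of a square system of forms without a nontrivial common zero:
it is the one of the corresponding pure powers of the variables. -/
theorem HasOnlyTrivialZero.finrank_formsIn [Fintype σ] [IsAlgClosed k] {h : σ → MvPolynomial σ k}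
    {e : σ → ℕ} (hh : ∀ i, (h i).IsHomogeneous (e i)) (he : ∀ i, 0 < e i)
    (hz : HasOnlyTrivialZero h) (S : Set σ) (s : ℕ) :
    Module.finrank k (formsIn (Ideal.span (h '' S)) s) =
      Nat.card {α : σ →₀ ℕ // α.degree = s ∧ ∃ i ∈ S, e i ≤ α i} := by
  have hh' : ∀ i, ((X i : MvPolynomial σ k) ^ e i).IsHomogeneous (e i) := fun i =>
    isHomogeneous_X_pow i _
  have hz' : HasOnlyTrivialZero fun i => (X i : MvPolynomial σ k) ^ e i := by
    intro v hv
    ext i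
    exact eq_zero_of_pow_eq_zero (by simpa using hv i)
  rw [IsPermRegular.finrank_formsIn_eq hh hh' (hz.isPermRegular hh he) (hz'.isPermRegular hh' he),
    formsIn_span_X_pow, finrank_restrictSupport]
  rfl

end Koszul

/-! ### Homogenization and dehomogenization -/

section Homogenize

variable {n : ℕ}

/-- Homogenization to a prescribed degree `s`: the monomial `x^α` goes to `x_0^{s - |α|} x^α`. It is
meaningful on polynomials of degree at most `s` only, where the exponent of `x_0` is not
truncated. -/
noncomputable def homogenizeTo (s : ℕ) :
    MvPolynomial (Fin n) ℂ →ₗ[ℂ] MvPolynomial (Fin (n + 1)) ℂ :=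
  (basisMonomials (Fin n) ℂ).constr ℂ fun α => monomial (Finsupp.cons (s - α.degree) α) 1

/-- The substitution `x_0 = 1`. -/
noncomputable def dehomogenize : MvPolynomial (Fin (n + 1)) ℂ →ₐ[ℂ] MvPolynomial (Fin n) ℂ :=
  aeval (Fin.cons 1 X)

theorem homogenizeTo_monomial (s : ℕ) (α : Fin n →₀ ℕ) (c : ℂ) :
    homogenizeTo s (monomial α c) = monomial (Finsupp.cons (s - α.degree) α) c := by
  have h1 : homogenizeTo s (monomial α (1 : ℂ)) = monomial (Finsupp.cons (s - α.degree) α) 1 := by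
    have := (basisMonomials (Fin n) ℂ).constr_basis ℂ
      (fun α => monomial (Finsupp.cons (s - α.degree) α) (1 : ℂ)) α
    rwa [coe_basisMonomials] at this
  have h2 : monomial α c = c • monomial α (1 : ℂ) := by simp [smul_monomial]
  rw [h2, map_smul, h1, smul_monomial, smul_eq_mul, mul_one]

theorem dehomogenize_monomial (m : ℕ) (α : Fin n →₀ ℕ) (c : ℂ) :
    dehomogenize (monomial (Finsupp.cons m α) c) = monomial α c := by
  rw [dehomogenize, aeval_monomial, monomial_eq (s := α), algebraMap_eq]
  congr 1
  rw [Finsupp.prod_fintype _ _ (by simp), Finsupp.prod_fintype _ _ (by simp), Fin.prod_univ_succ]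
  simp

theorem dehomogenize_homogenizeTo (s : ℕ) (p : MvPolynomial (Fin n) ℂ) :
    dehomogenize (homogenizeTo s p) = p := by
  rw [p.as_sum, map_sum, map_sum]
  simp only [homogenizeTo_monomial, dehomogenize_monomial]

theorem homogenizeTo_dehomogenize {s : ℕ} {P : MvPolynomial (Fin (n + 1)) ℂ}
    (hP : P.IsHomogeneous s) : homogenizeTo s (dehomogenize P) = P := by
  rw [P.as_sum, map_sum, map_sum]
  refine Finset.sum_congr rfl fun γ hγ => ?_
  have hd : γ.degree = s := by
    by_contra hne
    exact mem_support_iff.1 hγ (hP.coeff_eq_zero hne)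
  rw [← Finsupp.cons_tail γ, degree_cons] at hd
  nth_rw 1 [← Finsupp.cons_tail γ]
  rw [dehomogenize_monomial, homogenizeTo_monomial]
  congr 2
  conv_rhs => rw [← Finsupp.cons_tail γ]
  congr 1
  omega

/-- A form of given degree is determined by its dehomogenization. -/
theorem eq_of_dehomogenize_eq {s : ℕ} {P Q : MvPolynomial (Fin (n + 1)) ℂ}
    (hP : P.IsHomogeneous s) (hQ : Q.IsHomogeneous s) (h : dehomogenize P = dehomogenize Q) :
    P = Q := by
  rw [← homogenizeTo_dehomogenize hP, h, homogenizeTo_dehomogenize hQ]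

theorem isHomogeneous_homogenizeTo {s : ℕ} {p : MvPolynomial (Fin n) ℂ}
    (hp : p ∈ degreeLT ℂ (Fin n) (s + 1)) : (homogenizeTo s p).IsHomogeneous s := by
  rw [p.as_sum, map_sum]
  refine IsHomogeneous.sum _ _ _ fun α hα => ?_
  have : α.degree < s + 1 := hp hα
  rw [homogenizeTo_monomial]
  refine isHomogeneous_monomial _ ?_
  rw [degree_cons]
  omega

theorem dehomogenize_mem_degreeLT {s : ℕ} {P : MvPolynomial (Fin (n + 1)) ℂ}
    (hP : P.IsHomogeneous s) : dehomogenize P ∈ degreeLT ℂ (Fin n) (s + 1) := by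
  rw [P.as_sum, map_sum]
  refine Submodule.sum_mem _ fun γ hγ => ?_
  have hd : γ.degree = s := by
    by_contra hne
    exact mem_support_iff.1 hγ (hP.coeff_eq_zero hne)
  rw [← Finsupp.cons_tail γ, degree_cons] at hd
  rw [← Finsupp.cons_tail γ, dehomogenize_monomial, monomial_mem_restrictSupport]
  left
  show (Finsupp.tail γ).degree < s + 1
  omega

theorem homogenization_eq (f : MvPolynomial (Fin n) ℂ) :
    homogenization f = homogenizeTo f.totalDegree f := by
  conv_rhs => rw [f.as_sum]
  rw [map_sum]
  simp only [homogenizeTo_monomial]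
  rw [← f.as_sum]
  rfl

theorem dehomogenize_homogenization (f : MvPolynomial (Fin n) ℂ) :
    dehomogenize (homogenization f) = f := by
  rw [homogenization_eq, dehomogenize_homogenizeTo]

theorem mem_degreeLT_of_totalDegree_le {f : MvPolynomial (Fin n) ℂ} {s : ℕ}
    (hf : f.totalDegree ≤ s) : f ∈ degreeLT ℂ (Fin n) (s + 1) := by
  intro α hα
  have h : α.degree ≤ f.totalDegree := by
    simpa [Finsupp.degree_apply, Finsupp.sum] using le_totalDegree hα
  exact Nat.lt_succ_of_le (h.trans hf)

theorem mul_mem_degreeLT {p q : MvPolynomial (Fin n) ℂ} {a b : ℕ}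
    (hp : p ∈ degreeLT ℂ (Fin n) (a + 1)) (hq : q ∈ degreeLT ℂ (Fin n) (b + 1)) :
    p * q ∈ degreeLT ℂ (Fin n) (a + b + 1) := by
  classical
  intro γ hγ
  obtain ⟨α, hα, β, hβ, rfl⟩ := Finset.mem_add.1 (support_mul p q hγ)
  have h1 : α.degree < a + 1 := hp hα
  have h2 : β.degree < b + 1 := hq hβ
  show (α + β).degree < _
  rw [map_add]
  omega

end Homogenize

/-! ### The row space of the Macaulay matrix -/

section RowSpan

variable {n : ℕ} {d : Fin n → ℕ} {f : Fin n → MvPolynomial (Fin n) ℂ} {t : ℕ}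

/-- The row space of the dense Macaulay matrix as a space of polynomials: the combinations
`∑ aᵢ fᵢ` with `deg aᵢ + dᵢ ≤ t`. -/
noncomputable def rowSpan (d : Fin n → ℕ) (f : Fin n → MvPolynomial (Fin n) ℂ) (t : ℕ) :
    Submodule ℂ (MvPolynomial (Fin n) ℂ) :=
  Submodule.span ℂ (Set.range fun ρ : Row d t => monomial (ρ.2 : Fin n →₀ ℕ) 1 * f ρ.1)

theorem mul_mem_rowSpan {i : Fin n} {m : ℕ} (hm : m + d i = t) {p : MvPolynomial (Fin n) ℂ}
    (hp : p ∈ degreeLT ℂ (Fin n) (m + 1)) : p * f i ∈ rowSpan d f t := by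
  rw [p.as_sum, Finset.sum_mul]
  refine Submodule.sum_mem _ fun β hβ => ?_
  have hβ' : β.degree < m + 1 := hp hβ
  have : monomial β (coeff β p) * f i = coeff β p • (monomial β 1 * f i) := by
    rw [← smul_mul_assoc, smul_monomial, smul_eq_mul, mul_one]
  rw [this]
  exact Submodule.smul_mem _ _ (Submodule.subset_span ⟨⟨i, β, by omega⟩, rfl⟩)

theorem rowSpan_le_ideal : rowSpan d f t ≤ (systemIdeal f).restrictScalars ℂ := by
  refine Submodule.span_le.2 ?_
  rintro _ ⟨ρ, rfl⟩
  exact Ideal.mul_mem_left _ _ (Ideal.subset_span ⟨_, rfl⟩)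

theorem rowSpan_le_degreeLT (hd : ∀ i, (f i).totalDegree ≤ d i) :
    rowSpan d f t ≤ degreeLT ℂ (Fin n) (t + 1) := by
  refine Submodule.span_le.2 ?_
  rintro _ ⟨⟨i, β, hβ⟩, rfl⟩
  refine restrictSupport_mono _ ?_ (mul_mem_degreeLT (a := β.degree) (b := d i)
    (by simp) (mem_degreeLT_of_totalDegree_le (hd i)))
  intro α (hα : α.degree < _)
  show α.degree < t + 1
  omega

/-- The row space is the dehomogenization of the degree `t` part of the ideal of the homogenized
system. -/
theorem map_dehomogenize_formsIn (hd : ∀ i, (f i).totalDegree = d i) :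
    (formsIn (Ideal.span (Set.range fun i => homogenization (f i))) t).map
      dehomogenize.toLinearMap = rowSpan d f t := by
  have hF : ∀ i, (homogenization (f i)).IsHomogeneous (d i) := fun i =>
    hd i ▸ isHomogeneous_homogenization (f i)
  apply le_antisymm
  · rintro _ ⟨P, ⟨hP, hPt⟩, rfl⟩
    obtain ⟨c, rfl⟩ := Ideal.mem_span_range_iff_exists_fun.1 hP
    rw [← homogeneousComponent_eq_self hPt, map_sum, map_sum]
    refine Submodule.sum_mem _ fun i _ => ?_
    rcases lt_or_ge t (d i) with h | h
    · rw [homogeneousComponent_mul_of_lt (hF i) h, map_zero]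
      exact Submodule.zero_mem _
    · obtain ⟨m, hm⟩ := Nat.exists_eq_add_of_le' h
      rw [hm, homogeneousComponent_add_mul (hF i), ← hm, AlgHom.toLinearMap_apply, map_mul,
        dehomogenize_homogenization]
      exact mul_mem_rowSpan hm.symm
        (dehomogenize_mem_degreeLT (homogeneousComponent_isHomogeneous _ _))
  · refine Submodule.span_le.2 ?_
    rintro _ ⟨⟨i, β, hβ⟩, rfl⟩
    refine ⟨monomial (Finsupp.cons (t - β.degree - d i) β) 1 * homogenization (f i), ⟨?_, ?_⟩, ?_⟩
    · exact Ideal.mul_mem_left _ _ (Ideal.subset_span ⟨i, rfl⟩)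
    · have h1 : (monomial (Finsupp.cons (t - β.degree - d i) β) (1 : ℂ)).IsHomogeneous
          (t - d i) := isHomogeneous_monomial _ (by rw [degree_cons]; omega)
      have := h1.mul (hF i)
      rwa [Nat.sub_add_cancel (by omega)] at this
    · rw [AlgHom.toLinearMap_apply, map_mul, dehomogenize_monomial, dehomogenize_homogenization]

/-- If `x_0` is regular modulo the homogenized system, then the row space contains all elements of
degree at most `t` of the ideal. -/
theorem mem_rowSpan_of_regular (hd : ∀ i, (f i).totalDegree = d i)
    (hreg : ∀ P : MvPolynomial (Fin (n + 1)) ℂ,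
      P * X 0 ∈ Ideal.span (Set.range fun i => homogenization (f i)) →
      P ∈ Ideal.span (Set.range fun i => homogenization (f i)))
    {p : MvPolynomial (Fin n) ℂ} (hp : p ∈ degreeLT ℂ (Fin n) (t + 1)) (hpI : p ∈ systemIdeal f) :
    p ∈ rowSpan d f t := by
  have hF : ∀ i, (homogenization (f i)).IsHomogeneous (d i) := fun i =>
    hd i ▸ isHomogeneous_homogenization (f i)
  rw [← map_dehomogenize_formsIn hd]
  refine ⟨homogenizeTo t p, ⟨?_, isHomogeneous_homogenizeTo hp⟩, dehomogenize_homogenizeTo t p⟩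
  have hpow : ∀ (m : ℕ) (P : MvPolynomial (Fin (n + 1)) ℂ),
      P * X 0 ^ m ∈ Ideal.span (Set.range fun i => homogenization (f i)) →
      P ∈ Ideal.span (Set.range fun i => homogenization (f i)) := by
    intro m
    induction m with
    | zero => simp
    | succ m ih =>
      intro P hP
      refine ih P (hreg _ ?_)
      rwa [mul_assoc, ← pow_succ]
  obtain ⟨a, ha⟩ := Ideal.mem_span_range_iff_exists_fun.1 hpI
  choose m hm using fun i => exists_mem_degreeLT (a i)
  -- A degree to which `p` and all summands `aᵢ fᵢ` can be homogenized.
  let D := t + ∑ i, (m i + d i)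
  have hD : ∀ i, m i + d i ≤ D := fun i =>
    (Finset.single_le_sum (f := fun i => m i + d i) (fun _ _ => Nat.zero_le _)
      (Finset.mem_univ i)).trans (Nat.le_add_left _ _)
  have hDt : t ≤ D := Nat.le_add_right _ _
  refine hpow (D - t) _ ?_
  have key : homogenizeTo t p * X 0 ^ (D - t) =
      ∑ i, homogenizeTo (D - d i) (a i) * homogenization (f i) := by
    refine eq_of_dehomogenize_eq (s := D) ?_ ?_ ?_
    · have := (isHomogeneous_homogenizeTo hp).mul (isHomogeneous_X_pow (R := ℂ) (0 : Fin (n + 1))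
        (D - t))
      rwa [Nat.add_sub_cancel' hDt] at this
    · refine IsHomogeneous.sum _ _ _ fun i _ => ?_
      have h1 : a i ∈ degreeLT ℂ (Fin n) (D - d i + 1) := by
        refine restrictSupport_mono _ ?_ (hm i)
        intro α (hα : α.degree < _)
        show α.degree < _
        have := hD i
        omega
      have := (isHomogeneous_homogenizeTo h1).mul (hF i)
      rwa [Nat.sub_add_cancel (by have := hD i; omega)] at this
    · have hX : dehomogenize (X (0 : Fin (n + 1)) : MvPolynomial (Fin (n + 1)) ℂ) = 1 := by
        simp [dehomogenize]
      rw [map_mul, map_pow, hX, one_pow, mul_one, dehomogenize_homogenizeTo, map_sum, ← ha]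
      refine Finset.sum_congr rfl fun i _ => ?_
      rw [map_mul, dehomogenize_homogenizeTo, dehomogenize_homogenization]
  rw [key]
  exact Ideal.sum_mem _ fun i _ => Ideal.mul_mem_left _ _ (Ideal.subset_span ⟨i, rfl⟩)

end RowSpan

/-! ### The ideal of a generic system -/

section Generic

variable {n : ℕ} {d : Fin n → ℕ} {f : Fin n → MvPolynomial (Fin n) ℂ} {t : ℕ}

theorem degree_lt_of_mem_box (ht : t + n = (∑ i, d i) + 1) {α : Fin n →₀ ℕ}
    (hα : ∀ i, α i < d i) : α.degree < t := by
  have h : ∑ i, (α i + 1) ≤ ∑ i, d i := Finset.sum_le_sum fun i _ => hα i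
  rw [Finset.sum_add_distrib] at h
  simp only [Finset.sum_const, Finset.card_univ, Fintype.card_fin, smul_eq_mul, mul_one] at h
  rw [Finsupp.degree_eq_sum]
  omega

theorem card_boxExponents (d : Fin n → ℕ) :
    Nat.card {α : Fin n →₀ ℕ // ∀ i, α i < d i} = ∏ i, d i := by
  let E : {α : Fin n →₀ ℕ // ∀ i, α i < d i} ≃ ((i : Fin n) → Fin (d i)) :=
    { toFun := fun α i => ⟨α.1 i, α.2 i⟩
      invFun := fun g => ⟨Finsupp.equivFunOnFinite.symm fun i => g i, fun i => (g i).2⟩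
      left_inv := fun α => by ext; rfl
      right_inv := fun g => by ext; rfl }
  rw [Nat.card_congr E, Nat.card_pi]
  simp

theorem card_box (ht : t + n = (∑ i, d i) + 1) : (box d t).card = ∏ i, d i := by
  let E : box d t ≃ {α : Fin n →₀ ℕ // ∀ i, α i < d i} :=
    { toFun := fun α => ⟨α.1.1, by simpa [box] using α.2⟩
      invFun := fun α => ⟨⟨α.1, mem_degreeLE.2 (degree_lt_of_mem_box ht α.2).le⟩,
        by simpa [box] using α.2⟩
      left_inv := fun α => rfl
      right_inv := fun α => rfl }
  rw [← card_boxExponents, ← Nat.card_congr E, Nat.card_eq_fintype_card, Fintype.card_coe]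

/-- The facts about the ideal `I` of a system on which the linear algebra of the Macaulay matrix of
degree `t` rests: the row space exhausts the part of `I` of degree at most `t`, every monomial of
degree `t` is reducible to smaller degree by the rows, and `I` has the colength predicted by
Bézout's theorem. -/
structure IsResolvedInDegree (d : Fin n → ℕ) (f : Fin n → MvPolynomial (Fin n) ℂ) (t : ℕ) :
    Prop where
  mem_rowSpan : ∀ p ∈ systemIdeal f, p ∈ degreeLT ℂ (Fin n) (t + 1) → p ∈ rowSpan d f t
  degreeLT_le : degreeLT ℂ (Fin n) (t + 1) ≤ rowSpan d f t ⊔ degreeLT ℂ (Fin n) t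
  finrank_quotient :
    Module.finrank ℂ (MvPolynomial (Fin n) ℂ ⧸ systemIdeal f) = ∏ i, d i

/-- If the rows reduce all monomials of degree `t`, then all polynomials reduce to degree `< t`. -/
theorem ideal_sup_degreeLT_eq_top
    (hle : degreeLT ℂ (Fin n) (t + 1) ≤ rowSpan d f t ⊔ degreeLT ℂ (Fin n) t) :
    (systemIdeal f).restrictScalars ℂ ⊔ degreeLT ℂ (Fin n) t = ⊤ := by
  refine sup_degreeLT_eq_top fun α hα => ?_
  obtain ⟨β, hβ, hβt⟩ : ∃ β ≤ α, β.degree = t := Finsupp.exists_le_degree_eq α t hα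
  obtain ⟨γ, rfl⟩ := exists_add_of_le hβ
  obtain ⟨a, ha, b, hb, hab⟩ := Submodule.mem_sup.1
    (hle (x := monomial β 1) (by simp [hβt]))
  have : monomial (β + γ) (1 : ℂ) = a * monomial γ 1 + b * monomial γ 1 := by
    rw [← add_mul, hab, monomial_mul, one_mul]
  rw [this]
  refine Submodule.add_mem_sup (Ideal.mul_mem_right _ _ (rowSpan_le_ideal ha)) ?_
  intro δ hδ
  classical
  obtain ⟨μ, hμ, ν, hν, rfl⟩ := Finset.mem_add.1 (support_mul b _ hδ)
  have h1 : μ.degree < t := hb hμ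
  have h2 : ν = γ := by simpa using support_monomial_subset hν
  show (μ + ν).degree < (β + γ).degree
  rw [map_add, map_add, h2]
  omega

/-- A system with a nonzero constant among its members generates the unit ideal, already by
constant cofactors. -/
theorem isResolvedInDegree_of_degree_eq_zero (hne : ∀ i, f i ≠ 0)
    (hd : ∀ i, (f i).totalDegree = d i) {i : Fin n} (hi : d i = 0) :
    IsResolvedInDegree d f t := by
  have hc : f i = C (coeff 0 (f i)) := totalDegree_eq_zero_iff_eq_C.1 ((hd i).trans hi)
  have hc0 : coeff 0 (f i) ≠ 0 := by
    intro h
    rw [h, map_zero] at hc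
    exact hne i hc
  have hall : ∀ p, p ∈ degreeLT ℂ (Fin n) (t + 1) → p ∈ rowSpan d f t := by
    intro p hp
    have : p = ((coeff 0 (f i))⁻¹ • p) * f i := by
      rw [hc, coeff_C, if_pos rfl, mul_comm, C_mul', smul_smul, mul_inv_cancel₀ hc0, one_smul]
    rw [this]
    exact mul_mem_rowSpan (by omega) (Submodule.smul_mem _ _ hp)
  refine ⟨fun p _ hp => hall p hp, fun p hp => Submodule.mem_sup_left (hall p hp), ?_⟩
  have htop : systemIdeal f = ⊤ := by
    refine Ideal.eq_top_of_isUnit_mem (x := f i) _ (Ideal.subset_span ⟨i, rfl⟩) ?_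
    rw [hc]
    exact (isUnit_iff_ne_zero.2 hc0).map C
  have : Subsingleton (MvPolynomial (Fin n) ℂ ⧸ systemIdeal f) :=
    Ideal.Quotient.subsingleton_iff.2 htop
  rw [Module.finrank_zero_of_subsingleton, Finset.prod_eq_zero (Finset.mem_univ i) hi]

/-- The homogenized system together with `x_0`. -/
noncomputable def homogenizedSystem (f : Fin n → MvPolynomial (Fin n) ℂ) :
    Fin (n + 1) → MvPolynomial (Fin (n + 1)) ℂ :=
  Fin.cons (X 0) fun i => homogenization (f i)

theorem homogenizedSystem_image_compl :
    homogenizedSystem f '' {0}ᶜ = Set.range fun i => homogenization (f i) := by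
  rw [← Fin.range_succ, ← Set.range_comp]
  rfl

theorem isHomogeneous_homogenizedSystem (hd : ∀ i, (f i).totalDegree = d i) (j : Fin (n + 1)) :
    (homogenizedSystem f j).IsHomogeneous ((Fin.cons 1 d : Fin (n + 1) → ℕ) j) := by
  refine Fin.cases ?_ (fun i => ?_) j
  · exact isHomogeneous_X _ _
  · have := isHomogeneous_homogenization (f i)
    rwa [hd i] at this

theorem IsGenericSystem.hasOnlyTrivialZero (hf : IsGenericSystem d f) :
    HasOnlyTrivialZero (homogenizedSystem f) := by
  intro v hv
  by_contra hne
  have hmem : Projectivization.mk ℂ v hne ∈ projectiveZeros f :=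
    (mk_mem_projectiveZeros f v hne).2 fun i => hv i.succ
  obtain ⟨a, ha⟩ := Projectivization.exists_smul_eq_mk_rep ℂ v hne
  refine hf.not_at_infinity _ hmem ?_
  have h0 : v 0 = 0 := by simpa [homogenizedSystem] using hv 0
  rw [← ha]
  simp [h0]

/-- The dehomogenization `γ ↦ (γ_1, …, γ_n)` of exponents of degree `t`. -/
noncomputable def tailEquiv (n t : ℕ) :
    {γ : Fin (n + 1) →₀ ℕ // γ.degree = t} ≃ {α : Fin n →₀ ℕ // α.degree < t + 1} where
  toFun γ := ⟨Finsupp.tail γ.1, by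
    have := γ.2
    rw [← Finsupp.cons_tail γ.1, degree_cons] at this
    omega⟩
  invFun α := ⟨Finsupp.cons (t - α.1.degree) α.1, by
    have := α.2
    rw [degree_cons]
    omega⟩
  left_inv γ := by
    ext1
    have := γ.2
    rw [← Finsupp.cons_tail γ.1, degree_cons] at this
    conv_rhs => rw [← Finsupp.cons_tail γ.1]
    simp only
    congr 1
    omega
  right_inv α := by simp

theorem isResolvedInDegree_of_pos (ht : t + n = (∑ i, d i) + 1) (hf : IsGenericSystem d f)
    (hpos : ∀ i, 0 < d i) : IsResolvedInDegree d f t := by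
  have hd := hf.totalDegree_eq
  let e : Fin (n + 1) → ℕ := Fin.cons 1 d
  have hh : ∀ j, (homogenizedSystem f j).IsHomogeneous (e j) := isHomogeneous_homogenizedSystem hd
  have he : ∀ j, 0 < e j := fun j => Fin.cases Nat.one_pos hpos j
  have hz := hf.hasOnlyTrivialZero
  have hreg := hz.isPermRegular hh he
  have hrange := homogenizedSystem_image_compl (f := f)
  have hrow : ∀ p ∈ systemIdeal f, p ∈ degreeLT ℂ (Fin n) (t + 1) → p ∈ rowSpan d f t := by
    intro p hpI hp
    refine mem_rowSpan_of_regular hd (fun P hP => ?_) hp hpI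
    have := hreg {0}ᶜ 0 (by simp) P
    rw [hrange] at this
    exact this hP
  have hle : degreeLT ℂ (Fin n) (t + 1) ≤ rowSpan d f t ⊔ degreeLT ℂ (Fin n) t := by
    obtain ⟨s, rfl⟩ : ∃ s, t = s + 1 := by
      refine Nat.exists_eq_add_of_le' ?_
      have : ∑ i : Fin n, 1 ≤ ∑ i, d i := Finset.sum_le_sum fun i _ => hpos i
      simp only [Finset.sum_const, Finset.card_univ, Fintype.card_fin, smul_eq_mul,
        mul_one] at this
      omega
    -- No monomial of degree `t` has all exponents below `(1, d)`, so in degree `t` the ideal of the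
    -- homogenized system and `x_0` contains all forms.
    have hall : formsIn (Ideal.span (homogenizedSystem f '' Set.univ)) (s + 1) =
        homogeneousSubmodule (Fin (n + 1)) ℂ (s + 1) := by
      refine Submodule.eq_of_le_of_finrank_eq inf_le_right ?_
      rw [hz.finrank_formsIn hh he, homogeneousSubmodule_eq_finsupp_supported]
      refine Eq.trans ?_ (finrank_restrictSupport _).symm
      refine Nat.card_congr (Equiv.subtypeEquivRight fun γ => ⟨fun h => h.1, fun h => ⟨h, ?_⟩⟩)
      by_contra! hlt
      have h1 : ∀ i, Finsupp.tail γ i < d i := fun i => hlt i.succ (Set.mem_univ _)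
      have h2 : γ 0 < 1 := hlt 0 (Set.mem_univ _)
      have h3 := degree_lt_of_mem_box ht h1
      have h4 : γ.degree = s + 1 := h
      rw [← Finsupp.cons_tail γ, degree_cons] at h4
      omega
    intro p hp
    have hP := isHomogeneous_homogenizeTo hp
    have hmem : homogenizeTo (s + 1) p ∈
        Ideal.span (homogenizedSystem f '' insert 0 {0}ᶜ) := by
      have : homogenizeTo (s + 1) p ∈
          formsIn (Ideal.span (homogenizedSystem f '' Set.univ)) (s + 1) := hall ▸ hP
      have huniv : insert (0 : Fin (n + 1)) {0}ᶜ = Set.univ := by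
        ext j
        simp [em]
      rw [huniv]
      exact this.1
    obtain ⟨c, hc, hpc⟩ := exists_homogeneous_cofactor hh (i := 0) hP hmem
    rw [hrange] at hpc
    have hX : dehomogenize (homogenizedSystem f 0) = 1 := by
      simp [dehomogenize, homogenizedSystem]
    have hsum : p = dehomogenize (homogenizeTo (s + 1) p - c * homogenizedSystem f 0) +
        dehomogenize c := by
      rw [map_sub, map_mul, hX, dehomogenize_homogenizeTo]
      ring
    rw [hsum]
    refine Submodule.add_mem_sup ?_ (dehomogenize_mem_degreeLT hc)
    rw [← map_dehomogenize_formsIn hd]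
    exact ⟨_, ⟨hpc, hP.sub (hc.mul (hh 0))⟩, rfl⟩
  refine ⟨hrow, hle, ?_⟩
  have hfinLT : Finite {α : Fin n →₀ ℕ | α.degree < t + 1} := finite_setOf_degree_lt _ _
  have : FiniteDimensional ℂ (degreeLT ℂ (Fin n) (t + 1)) :=
    Module.Finite.of_basis (basisRestrictSupport ℂ _)
  -- The dimension of the row space is read off the Hilbert function of the homogenized system.
  have hrank : Module.finrank ℂ (rowSpan d f t) =
      Nat.card {α : Fin n →₀ ℕ // α.degree < t + 1 ∧ ∃ i, d i ≤ α i} := by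
    rw [← map_dehomogenize_formsIn hd, ← hrange]
    have hinj : Function.Injective ((dehomogenize (n := n)).toLinearMap.domRestrict
        (formsIn (Ideal.span (homogenizedSystem f '' {0}ᶜ)) t)) := by
      intro P Q hPQ
      exact Subtype.ext (eq_of_dehomogenize_eq P.2.2 Q.2.2 hPQ)
    have := LinearMap.finrank_range_of_inj hinj
    rw [LinearMap.range_domRestrict] at this
    rw [this, hz.finrank_formsIn hh he]
    refine Nat.card_congr ((Equiv.subtypeSubtypeEquivSubtypeInter _ _).symm.trans
      (((tailEquiv n t).subtypeEquiv fun γ => ?_).trans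
        (Equiv.subtypeSubtypeEquivSubtypeInter _ fun α : Fin n →₀ ℕ => ∃ i, d i ≤ α i)))
    constructor
    · rintro ⟨j, hj, hle⟩
      obtain ⟨i, rfl⟩ := Fin.exists_succ_eq.2 hj
      exact ⟨i, hle⟩
    · rintro ⟨i, hle⟩
      exact ⟨i.succ, Fin.succ_ne_zero i, hle⟩
  have hquot : Module.finrank ℂ (MvPolynomial (Fin n) ℂ ⧸ systemIdeal f) +
      Module.finrank ℂ (rowSpan d f t) = Module.finrank ℂ (degreeLT ℂ (Fin n) (t + 1)) := by
    let π := (Ideal.Quotient.mkₐ ℂ (systemIdeal f)).toLinearMap.domRestrict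
      (degreeLT ℂ (Fin n) (t + 1))
    have hπ : Function.Surjective π := by
      refine mk_domRestrict_surjective (eq_top_iff.2 ?_)
      rw [← ideal_sup_degreeLT_eq_top hle]
      refine sup_le_sup_left (restrictSupport_mono _ fun α (hα : α.degree < t) => ?_) _
      exact Nat.lt_succ_of_lt hα
    have hker : LinearMap.ker π =
        (rowSpan d f t).comap (degreeLT ℂ (Fin n) (t + 1)).subtype := by
      ext p
      have : π p = Ideal.Quotient.mk (systemIdeal f) p.1 := rfl
      rw [LinearMap.mem_ker, this, Ideal.Quotient.eq_zero_iff_mem, Submodule.mem_comap]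
      exact ⟨fun h => hrow _ h p.2, fun h => rowSpan_le_ideal h⟩
    have := LinearMap.finrank_range_add_finrank_ker π
    rw [LinearMap.range_eq_top.2 hπ, finrank_top, hker, (Submodule.comapSubtypeEquivOfLe
      (rowSpan_le_degreeLT fun i => (hd i).le)).finrank_eq] at this
    exact this
  rw [hrank, finrank_restrictSupport] at hquot
  have hcount : Nat.card {α : Fin n →₀ ℕ | α.degree < t + 1} =
      Nat.card {α : Fin n →₀ ℕ // ∀ i, α i < d i} +
        Nat.card {α : Fin n →₀ ℕ // α.degree < t + 1 ∧ ∃ i, d i ≤ α i} := by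
    have hunion : {α : Fin n →₀ ℕ | α.degree < t + 1} =
        {α | ∀ i, α i < d i} ∪ {α | α.degree < t + 1 ∧ ∃ i, d i ≤ α i} := by
      ext α
      simp only [Set.mem_union, Set.mem_ofPred_eq]
      constructor
      · intro h
        by_cases hb : ∀ i, α i < d i
        · exact Or.inl hb
        · push Not at hb
          exact Or.inr ⟨h, hb⟩
      · rintro (h | h)
        · exact Nat.lt_succ_of_lt (degree_lt_of_mem_box ht h)
        · exact h.1
    have hdisj : Disjoint {α : Fin n →₀ ℕ | ∀ i, α i < d i}
        {α | α.degree < t + 1 ∧ ∃ i, d i ≤ α i} := by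
      rw [Set.disjoint_left]
      rintro α h ⟨-, i, hi⟩
      exact (h i).not_ge hi
    have hfin := finite_setOf_degree_lt (Fin n) (t + 1)
    rw [hunion] at hfin
    have := Set.ncard_union_eq hdisj (hfin.subset Set.subset_union_left)
      (hfin.subset Set.subset_union_right)
    rw [← hunion] at this
    exact this
  rw [hcount, card_boxExponents] at hquot
  exact Nat.add_right_cancel hquot

theorem IsGenericSystem.isResolvedInDegree (ht : t + n = (∑ i, d i) + 1)
    (hf : IsGenericSystem d f) : IsResolvedInDegree d f t := by
  by_cases h : ∃ i, d i = 0
  · obtain ⟨i, hi⟩ := h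
    exact isResolvedInDegree_of_degree_eq_zero hf.ne_zero hf.totalDegree_eq hi
  · push Not at h
    exact isResolvedInDegree_of_pos ht hf fun i => Nat.pos_of_ne_zero (h i)

end Generic

/-! ### Linear algebra of the Macaulay matrix -/

section LinearAlgebra

variable {n : ℕ} {d : Fin n → ℕ} {f : Fin n → MvPolynomial (Fin n) ℂ} {t : ℕ}

instance (d : Fin n → ℕ) (t : ℕ) : Finite (Row d t) := by
  have : ∀ i : Fin n, Finite {β : Fin n →₀ ℕ // β.degree + d i ≤ t} := fun i =>
    Set.Finite.to_subtype (s := {β : Fin n →₀ ℕ | β.degree + d i ≤ t})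
      ((Finsupp.finite_of_degree_le (σ := Fin n) t).subset
        fun β (hβ : β.degree + d i ≤ t) => (Nat.le_add_right _ _).trans hβ)
  infer_instance

/-- The coefficients of a polynomial at a family of columns. -/
noncomputable def coeffsAt {m : Type*} (g : m → Col n t) :
    MvPolynomial (Fin n) ℂ →ₗ[ℂ] (m → ℂ) :=
  LinearMap.pi fun j => lcoeff ℂ (g j : Fin n →₀ ℕ)

theorem coeffsAt_apply {m : Type*} (g : m → Col n t) (p : MvPolynomial (Fin n) ℂ) (j : m) :
    coeffsAt g p j = coeff (g j : Fin n →₀ ℕ) p := rfl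

theorem span_row_submatrix {m : Type*} (g : m → Col n t) :
    Submodule.span ℂ (Set.range ((denseMatrix d f t).submatrix id g).row) =
      (rowSpan d f t).map (coeffsAt g) := by
  rw [rowSpan, Submodule.map_span, ← Set.range_comp]
  rfl

theorem rank_submatrix_eq {m : Type*} [Fintype m] (g : m → Col n t) :
    ((denseMatrix d f t).submatrix id g).rank =
      Module.finrank ℂ ((rowSpan d f t).map (coeffsAt g)) := by
  rw [Matrix.rank_eq_finrank_span_row, span_row_submatrix]

theorem finrank_map_of_injOn {V W : Type*} [AddCommGroup V] [Module ℂ V] [AddCommGroup W]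
    [Module ℂ W] (φ : V →ₗ[ℂ] W) (U : Submodule ℂ V) (h : ∀ x ∈ U, φ x = 0 → x = 0) :
    Module.finrank ℂ (U.map φ) = Module.finrank ℂ U := by
  have hinj : Function.Injective (φ.domRestrict U) := by
    rw [injective_iff_map_eq_zero]
    exact fun x hx => Subtype.ext (h x x.2 hx)
  rw [← LinearMap.range_domRestrict, LinearMap.finrank_range_of_inj hinj]

theorem borderBlock_rank (hle : degreeLT ℂ (Fin n) (t + 1) ≤ rowSpan d f t ⊔ degreeLT ℂ (Fin n) t) :
    (borderBlock d f t).rank = Fintype.card {α : Col n t // (α : Fin n →₀ ℕ).degree = t} := by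
  suffices h : (rowSpan d f t).map (coeffsAt Subtype.val :
      _ →ₗ[ℂ] ({α : Col n t // (α : Fin n →₀ ℕ).degree = t} → ℂ)) = ⊤ by
    rw [borderBlock, rank_submatrix_eq, h, finrank_top, Module.finrank_fintype_fun_eq_card]
  refine eq_top_iff.2 fun w _ => ?_
  let p : MvPolynomial (Fin n) ℂ :=
    ∑ α : {α : Col n t // (α : Fin n →₀ ℕ).degree = t}, monomial (α.1 : Fin n →₀ ℕ) (w α)
  have hp : p ∈ degreeLT ℂ (Fin n) (t + 1) :=
    Submodule.sum_mem _ fun α _ => by simp [α.2]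
  obtain ⟨a, ha, b, hb, hab⟩ := Submodule.mem_sup.1 (hle hp)
  refine ⟨a, ha, ?_⟩
  ext α
  have hbα : coeff (α.1 : Fin n →₀ ℕ) b = 0 := by
    by_contra hne
    have : (α.1 : Fin n →₀ ℕ).degree < t := hb (mem_support_iff.2 hne)
    exact this.ne α.2
  have hpα : coeff (α.1 : Fin n →₀ ℕ) p = w α := by
    classical
    simp only [p, coeff_sum, coeff_monomial]
    rw [Finset.sum_eq_single α]
    · simp
    · intro β _ hβ
      rw [if_neg]
      exact fun h => hβ (Subtype.ext (Subtype.ext h))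
    · simp
  rw [coeffsAt_apply, ← hpα, ← hab, coeff_add, hbα, add_zero]

/-- The span of the monomials in `O`. -/
noncomputable abbrev monomialSpan (O : Finset (Col n t)) : Submodule ℂ (MvPolynomial (Fin n) ℂ) :=
  Submodule.span ℂ (Set.range fun α : O => (monomial (α.1 : Fin n →₀ ℕ) 1 :
    MvPolynomial (Fin n) ℂ))

theorem monomialSpan_le {O : Finset (Col n t)} : monomialSpan O ≤ degreeLT ℂ (Fin n) (t + 1) := by
  refine Submodule.span_le.2 ?_
  rintro _ ⟨α, rfl⟩
  have := mem_degreeLE.1 α.1.2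
  simp only [SetLike.mem_coe, monomial_mem_restrictSupport]
  exact Or.inl (Nat.lt_succ_of_le this)

theorem mem_monomialSpan_of_support {O : Finset (Col n t)} {p : MvPolynomial (Fin n) ℂ}
    (h : ∀ α ∈ p.support, ∃ γ ∈ O, (γ : Fin n →₀ ℕ) = α) : p ∈ monomialSpan O := by
  rw [p.as_sum]
  refine Submodule.sum_mem _ fun α hα => ?_
  obtain ⟨γ, hγ, rfl⟩ := h α hα
  have : monomial (γ : Fin n →₀ ℕ) (coeff γ p) = coeff (γ : Fin n →₀ ℕ) p • monomial ↑γ (1 : ℂ) := by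
    rw [smul_monomial, smul_eq_mul, mul_one]
  rw [this]
  exact Submodule.smul_mem _ _ (Submodule.subset_span ⟨⟨γ, hγ⟩, rfl⟩)

theorem IsQuotientBasis.eq_zero {O : Finset (Col n t)} (hO : IsQuotientBasis f O)
    {p : MvPolynomial (Fin n) ℂ} (hp : p ∈ monomialSpan O) (hpI : p ∈ systemIdeal f) : p = 0 := by
  obtain ⟨c, rfl⟩ := (Submodule.mem_span_range_iff_exists_fun ℂ).1 hp
  have h0 : ∑ α : O, c α • Ideal.Quotient.mk (systemIdeal f)
      (monomial (α.1 : Fin n →₀ ℕ) (1 : ℂ)) = 0 := by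
    have := (Ideal.Quotient.eq_zero_iff_mem.2 hpI)
    rw [map_sum] at this
    exact this
  have := Fintype.linearIndependent_iff.1 hO.1 c h0
  simp [this]

theorem span_mk_monomials_eq_map {O : Finset (Col n t)} :
    Submodule.span ℂ (Set.range fun α : O =>
      Ideal.Quotient.mk (systemIdeal f) (monomial (α.1 : Fin n →₀ ℕ) 1)) =
      (monomialSpan O).map (Ideal.Quotient.mkₐ ℂ (systemIdeal f)).toLinearMap := by
  rw [Submodule.map_span, ← Set.range_comp]
  rfl

/-- For a resolved system every monomial basis of the quotient of degree less than `t` has all the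
required properties: the row space is the part of the ideal of degree at most `t`, so it contains
`x^α - h` for the normal form `h`, and it meets the span of `O` trivially. -/
theorem IsResolvedInDegree.isBasisChoice (hf : IsResolvedInDegree d f t)
    (hd : ∀ i, (f i).totalDegree ≤ d i) {O : Finset (Col n t)}
    (hlt : ∀ α ∈ O, (α : Fin n →₀ ℕ).degree < t) (hO : IsQuotientBasis f O) :
    IsBasisChoice d f t O where
  degree_lt := hlt
  card_eq := by
    rw [← hf.finrank_quotient, Module.finrank_eq_card_basis (Module.Basis.mk hO.1 hO.2.ge),
      Fintype.card_coe]
  rank_eq := by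
    let g : {α : Col n t // (α : Fin n →₀ ℕ).degree = t} ⊕
        {α : Col n t // (α : Fin n →₀ ℕ).degree < t ∧ α ∉ O} → Col n t :=
      Sum.elim Subtype.val Subtype.val
    have h1 : Matrix.fromCols (borderBlock d f t) (interiorBlock d f t O) =
        (denseMatrix d f t).submatrix id g := by
      ext ρ (α | α) <;> rfl
    have h2 : denseMatrix d f t = (denseMatrix d f t).submatrix id id := rfl
    rw [h1, rank_submatrix_eq, h2, rank_submatrix_eq, finrank_map_of_injOn, finrank_map_of_injOn]
    · intro p hp hp0
      ext α
      by_contra hne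
      have hα : α.degree < t + 1 := rowSpan_le_degreeLT hd hp (mem_support_iff.2 hne)
      exact hne (congrFun hp0 ⟨α, mem_degreeLE.2 (Nat.le_of_lt_succ hα)⟩)
    · intro p hp hp0
      refine hO.eq_zero (mem_monomialSpan_of_support fun α hα => ?_) (rowSpan_le_ideal hp)
      have hαt : α.degree < t + 1 := rowSpan_le_degreeLT hd hp hα
      by_contra! hαO
      have hγ := fun h => hαO ⟨α, mem_degreeLE.2 (Nat.le_of_lt_succ hαt)⟩ h rfl
      refine mem_support_iff.1 hα ?_
      rcases (Nat.le_of_lt_succ hαt).eq_or_lt with h | h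
      · exact congrFun hp0 (Sum.inl ⟨⟨α, mem_degreeLE.2 h.le⟩, h⟩)
      · exact congrFun hp0 (Sum.inr ⟨⟨α, mem_degreeLE.2 h.le⟩, h, hγ⟩)
  basis := hO
  normalForm := by
    intro α _
    have hmem : Ideal.Quotient.mk (systemIdeal f) (monomial (α : Fin n →₀ ℕ) 1) ∈
        (monomialSpan O).map (Ideal.Quotient.mkₐ ℂ (systemIdeal f)).toLinearMap := by
      rw [← span_mk_monomials_eq_map]
      exact hO.2.symm ▸ Submodule.mem_top
    obtain ⟨h, hhO, hh⟩ := hmem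
    have hI : monomial (α : Fin n →₀ ℕ) 1 - h ∈ systemIdeal f := Ideal.Quotient.eq.1 hh.symm
    refine ⟨h, ⟨hhO, hI⟩, ?_, ?_⟩
    · rintro h' ⟨hh'O, hh'I⟩
      refine sub_eq_zero.1 (hO.eq_zero (Submodule.sub_mem _ hh'O hhO) ?_)
      have := Ideal.sub_mem _ hI hh'I
      rwa [sub_sub_sub_cancel_left] at this
    · have h2 : denseMatrix d f t = (denseMatrix d f t).submatrix id id := rfl
      rw [h2, span_row_submatrix]
      refine ⟨_, hf.mem_rowSpan _ hI (Submodule.sub_mem _ ?_ (monomialSpan_le hhO)), rfl⟩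
      have := mem_degreeLE.1 α.2
      simp only [monomial_mem_restrictSupport]
      exact Or.inl (Nat.lt_succ_of_le this)

theorem exists_quotientBasis
    (hle : degreeLT ℂ (Fin n) (t + 1) ≤ rowSpan d f t ⊔ degreeLT ℂ (Fin n) t) :
    ∃ O : Finset (Col n t), (∀ α ∈ O, (α : Fin n →₀ ℕ).degree < t) ∧ IsQuotientBasis f O := by
  classical
  let v : {α : Col n t // (α : Fin n →₀ ℕ).degree < t} → MvPolynomial (Fin n) ℂ ⧸ systemIdeal f :=
    fun α => Ideal.Quotient.mk (systemIdeal f) (monomial (α.1 : Fin n →₀ ℕ) 1)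
  have hv : Submodule.span ℂ (Set.range v) = ⊤ := by
    refine eq_top_iff.2 fun x _ => ?_
    obtain ⟨⟨p, hp⟩, rfl⟩ := mk_domRestrict_surjective (ideal_sup_degreeLT_eq_top hle) x
    have : degreeLT ℂ (Fin n) t ≤ (Submodule.span ℂ (Set.range v)).comap
        (Ideal.Quotient.mkₐ ℂ (systemIdeal f)).toLinearMap := by
      rw [degreeLT, restrictSupport_eq_span, Submodule.span_le]
      rintro _ ⟨α, hα, rfl⟩
      have hα' : α.degree < t := hα
      exact Submodule.subset_span ⟨⟨⟨α, mem_degreeLE.2 hα'.le⟩, hα'⟩, rfl⟩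
    exact this hp
  obtain ⟨κ, a, ha, hspan, hli⟩ := exists_linearIndependent' ℂ v
  have : Finite κ := Finite.of_injective a ha
  have : Fintype κ := Fintype.ofFinite κ
  let O : Finset (Col n t) := Finset.univ.image fun x => (a x).1
  let e : κ ≃ O := Equiv.ofBijective
    (fun x => ⟨(a x).1, Finset.mem_image_of_mem _ (Finset.mem_univ x)⟩) (by
      constructor
      · intro x y hxy
        exact ha (Subtype.ext (congrArg (Subtype.val : O → Col n t) hxy))
      · rintro ⟨α, hα⟩
        obtain ⟨x, -, rfl⟩ := Finset.mem_image.1 hα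
        exact ⟨x, rfl⟩)
  refine ⟨O, ?_, ?_, ?_⟩
  · intro α hα
    obtain ⟨x, -, rfl⟩ := Finset.mem_image.1 hα
    exact (a x).2
  · exact (linearIndependent_equiv e).1 hli
  · rw [← e.surjective.range_comp]
    exact hspan.trans hv

end LinearAlgebra

/-! ### Minors of the generic Macaulay matrix -/

section Minors

variable {n : ℕ} {d : Fin n → ℕ} {f : Fin n → MvPolynomial (Fin n) ℂ} {t : ℕ}

/-- The entry of the dense Macaulay matrix as a polynomial in the coefficients of the system. -/
noncomputable def genericEntry (ρ : Row d t) (γ : Col n t) :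
    MvPolynomial (Σ i : Fin n, degreeLE n (d i)) ℂ :=
  open Classical in
  if h : (ρ.2 : Fin n →₀ ℕ) ≤ γ ∧ ((γ : Fin n →₀ ℕ) - ρ.2).degree ≤ d ρ.1 then
    X ⟨ρ.1, (γ : Fin n →₀ ℕ) - ρ.2, mem_degreeLE.2 h.2⟩ else 0

theorem eval_genericEntry (hd : ∀ i, (f i).totalDegree ≤ d i) (ρ : Row d t) (γ : Col n t) :
    eval (coeffVector d f) (genericEntry ρ γ) = denseMatrix d f t ρ γ := by
  classical
  rw [denseMatrix, Matrix.of_apply, coeff_monomial_mul', genericEntry]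
  by_cases h1 : (ρ.2 : Fin n →₀ ℕ) ≤ γ
  · by_cases h2 : ((γ : Fin n →₀ ℕ) - ρ.2).degree ≤ d ρ.1
    · rw [dif_pos ⟨h1, h2⟩, if_pos h1, eval_X, one_mul]
      rfl
    · rw [dif_neg fun h => h2 h.2, if_pos h1, map_zero, one_mul]
      by_contra hne
      have := mem_degreeLT_of_totalDegree_le (hd ρ.1) (mem_support_iff.2 (Ne.symm hne))
      exact h2 (Nat.le_of_lt_succ this)
  · rw [dif_neg fun h => h1 h.1, if_neg h1, map_zero]

/-- A square minor of the dense Macaulay matrix as a polynomial in the coefficients of the system. -/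
noncomputable def genericMinor {C : Type*} [Fintype C] [DecidableEq C] (ρ : C → Row d t)
    (g : C → Col n t) : MvPolynomial (Σ i : Fin n, degreeLE n (d i)) ℂ :=
  (Matrix.of fun c c' => genericEntry (ρ c) (g c')).det

variable {C : Type*} [Fintype C] [DecidableEq C]

theorem eval_genericMinor (hd : ∀ i, (f i).totalDegree ≤ d i) (ρ : C → Row d t)
    (g : C → Col n t) : eval (coeffVector d f) (genericMinor ρ g) =
      ((denseMatrix d f t).submatrix ρ g).det := by
  rw [genericMinor, RingHom.map_det]
  congr 1
  ext c c'
  exact eval_genericEntry hd _ _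

/-- For every choice of monomials outside the box there are rows whose minor is a nonzero polynomial
in the coefficients: at the system `x_i^{d_i}` the minor is that of the identity matrix. -/
theorem exists_genericMinor_eval_eq_one (g : C → Col n t) (hg : Function.Injective g)
    (hbox : ∀ c, ∃ i, d i ≤ (g c : Fin n →₀ ℕ) i) :
    ∃ ρ : C → Row d t, eval (coeffVector d fun i => X i ^ d i) (genericMinor ρ g) = 1 := by
  choose i hi using hbox
  have hle : ∀ c, Finsupp.single (i c) (d (i c)) ≤ (g c : Fin n →₀ ℕ) := by
    intro c
    rw [Finsupp.single_le_iff]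
    exact hi c
  have hdeg : ∀ c, ((g c : Fin n →₀ ℕ) - Finsupp.single (i c) (d (i c))).degree + d (i c) ≤ t := by
    intro c
    have h1 := congrArg Finsupp.degree (tsub_add_cancel_of_le (hle c))
    rw [map_add, Finsupp.degree_single] at h1
    rw [h1]
    exact mem_degreeLE.1 (g c).2
  refine ⟨fun c => ⟨i c, _, hdeg c⟩, ?_⟩
  rw [eval_genericMinor fun i => (isHomogeneous_X_pow i _).totalDegree_le]
  convert Matrix.det_one (n := C) (R := ℂ)
  ext c c'
  rw [Matrix.submatrix_apply, denseMatrix, Matrix.of_apply, X_pow_eq_monomial, monomial_mul,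
    tsub_add_cancel_of_le (hle c), coeff_monomial, Matrix.one_apply, one_mul]
  simp only [Subtype.val_inj, hg.eq_iff]

/-- A nonvanishing minor allows the monomials of its columns to be eliminated by the rows. -/
theorem exists_mem_rowSpan_of_det_ne_zero {ρ : C → Row d t} {g : C → Col n t}
    (hdet : ((denseMatrix d f t).submatrix ρ g).det ≠ 0) (p : MvPolynomial (Fin n) ℂ) :
    ∃ q ∈ rowSpan d f t, ∀ c, coeff (g c : Fin n →₀ ℕ) (p - q) = 0 := by
  let B := (denseMatrix d f t).submatrix ρ g
  let w : C → ℂ := Matrix.vecMul (coeffsAt g p) B⁻¹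
  refine ⟨∑ c, w c • (monomial ((ρ c).2 : Fin n →₀ ℕ) 1 * f (ρ c).1),
    Submodule.sum_mem _ fun c _ => Submodule.smul_mem _ _ (Submodule.subset_span ⟨ρ c, rfl⟩), ?_⟩
  have hw : Matrix.vecMul w B = coeffsAt g p := by
    rw [Matrix.vecMul_vecMul, Matrix.nonsing_inv_mul _ (isUnit_iff_ne_zero.2 hdet),
      Matrix.vecMul_one]
  intro c
  have hc := congrFun hw c
  rw [coeffsAt_apply] at hc
  rw [coeff_sub, ← hc, coeff_sum, sub_eq_zero]
  simp only [coeff_smul]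
  rfl

end Minors

/-! ### Systems at which the minors do not vanish -/

section Nonvanishing

variable {n : ℕ} {d : Fin n → ℕ} {f : Fin n → MvPolynomial (Fin n) ℂ} {t : ℕ}

/-- If the rows reduce all monomials of degree `t`, then the homogenized system has no zero at
infinity: evaluation of the homogenization of degree `t` at such a zero annihilates the row space
and all polynomials of degree less than `t`. -/
theorem rep_zero_ne_zero_of_mem_projectiveZeros (hd : ∀ i, (f i).totalDegree = d i)
    (hle : degreeLT ℂ (Fin n) (t + 1) ≤ rowSpan d f t ⊔ degreeLT ℂ (Fin n) t)
    {z : Projectivization ℂ (Fin (n + 1) → ℂ)} (hz : z ∈ projectiveZeros f) : z.rep 0 ≠ 0 := by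
  intro h0
  set v := z.rep
  let L : MvPolynomial (Fin n) ℂ →ₗ[ℂ] ℂ := (aeval v).toLinearMap ∘ₗ homogenizeTo t
  have hL : ∀ p, L p = eval v (homogenizeTo t p) := fun p => by simp [L, aeval_eq_eval]
  have hrow : rowSpan d f t ≤ LinearMap.ker L := by
    rw [← map_dehomogenize_formsIn hd]
    rintro _ ⟨P, ⟨hP, hPt⟩, rfl⟩
    rw [LinearMap.mem_ker, hL, AlgHom.toLinearMap_apply, homogenizeTo_dehomogenize hPt]
    have : Ideal.span (Set.range fun i => homogenization (f i)) ≤ RingHom.ker (eval v) := by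
      rw [Ideal.span_le]
      rintro _ ⟨i, rfl⟩
      exact hz i
    exact this hP
  have hlow : degreeLT ℂ (Fin n) t ≤ LinearMap.ker L := by
    rw [degreeLT, restrictSupport_eq_span, Submodule.span_le]
    rintro _ ⟨α, hα, rfl⟩
    have hα' : α.degree < t := hα
    rw [SetLike.mem_coe, LinearMap.mem_ker, hL, homogenizeTo_monomial, eval_monomial,
      Finsupp.prod_fintype _ _ (by simp), Fin.prod_univ_succ, h0, Finsupp.cons_zero,
      zero_pow (by omega), zero_mul, mul_zero]
  have hall : degreeLT ℂ (Fin n) (t + 1) ≤ LinearMap.ker L := hle.trans (sup_le hrow hlow)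
  have hmon : ∀ α : Fin n →₀ ℕ, α.degree = t → ∏ i, v i.succ ^ α i = 0 := by
    intro α hα
    have : L (monomial α 1) = 0 := hall (x := monomial α 1) (by simp [hα])
    rw [hL, homogenizeTo_monomial, eval_monomial,
      Finsupp.prod_fintype _ _ (by simp), Fin.prod_univ_succ, hα] at this
    simpa using this
  refine z.rep_nonzero (funext fun j => Fin.cases h0 (fun i => ?_) j)
  have := hmon (Finsupp.single i t) (by simp)
  rw [Finset.prod_eq_single i (fun j _ hj => by simp [hj.symm])
    (by simp)] at this
  exact eq_zero_of_pow_eq_zero (by simpa using this)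

theorem eval_cons_one (w : Fin n → ℂ) (P : MvPolynomial (Fin (n + 1)) ℂ) :
    eval (Fin.cons 1 w) P = eval w (dehomogenize P) := by
  have : (aeval (Fin.cons 1 w : Fin (n + 1) → ℂ) : _ →ₐ[ℂ] ℂ) = (aeval w).comp dehomogenize := by
    ext j
    refine Fin.cases ?_ (fun i => ?_) j <;> simp [dehomogenize]
  exact DFunLike.congr_fun this P

theorem finite_projectiveZeros
    (htop : (systemIdeal f).restrictScalars ℂ ⊔ degreeLT ℂ (Fin n) t = ⊤)
    (hinf : ∀ z ∈ projectiveZeros f, z.rep 0 ≠ 0) : (projectiveZeros f).Finite := by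
  have := finite_quotient_of_sup_degreeLT htop
  have hne : ∀ w : Fin n → ℂ, (Fin.cons 1 w : Fin (n + 1) → ℂ) ≠ 0 := fun w h => by
    simpa using congrFun h 0
  refine ((finite_zeros_of_finite_quotient (systemIdeal f)).image
    fun w => Projectivization.mk ℂ (Fin.cons 1 w) (hne w)).subset fun z hz => ?_
  have h0 := hinf z hz
  let w : Fin n → ℂ := fun i => (z.rep 0)⁻¹ * z.rep i.succ
  have hw : (Fin.cons 1 w : Fin (n + 1) → ℂ) = (z.rep 0)⁻¹ • z.rep := by
    funext j
    refine Fin.cases ?_ (fun i => ?_) j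
    · simp [h0]
    · simp [w]
  have hmk : Projectivization.mk ℂ (Fin.cons 1 w) (hne w) = z := by
    rw [← z.mk_rep, Projectivization.mk_eq_mk_iff']
    exact ⟨_, hw.symm⟩
  refine ⟨w, ?_, hmk⟩
  rw [← hmk, mk_mem_projectiveZeros] at hz
  have hle : systemIdeal f ≤ RingHom.ker (eval w) := by
    rw [systemIdeal, Ideal.span_le]
    rintro _ ⟨i, rfl⟩
    have := hz i
    rwa [eval_cons_one, dehomogenize_homogenization] at this
  exact fun p hp => hle hp

/-- The monomials in the box span the quotient as soon as the rows eliminate all others; by the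
dimension count they form a basis. -/
theorem isQuotientBasis_box (ht : t + n = (∑ i, d i) + 1) (hf : IsResolvedInDegree d f t)
    (hd : ∀ i, (f i).totalDegree ≤ d i)
    (helim : ∀ p : MvPolynomial (Fin n) ℂ, ∃ q ∈ rowSpan d f t,
      ∀ γ : Col n t, γ ∉ box d t → coeff (γ : Fin n →₀ ℕ) (p - q) = 0) :
    IsQuotientBasis f (box d t) := by
  have hspan : Submodule.span ℂ (Set.range fun α : box d t =>
      Ideal.Quotient.mk (systemIdeal f) (monomial (α.1 : Fin n →₀ ℕ) 1)) = ⊤ := by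
    rw [span_mk_monomials_eq_map, eq_top_iff]
    intro x _
    obtain ⟨⟨p, hp⟩, rfl⟩ := mk_domRestrict_surjective (ideal_sup_degreeLT_eq_top hf.degreeLT_le) x
    obtain ⟨q, hq, hpq⟩ := helim p
    have hp' : p ∈ degreeLT ℂ (Fin n) (t + 1) :=
      restrictSupport_mono _ (fun α (hα : α.degree < t) => Nat.lt_succ_of_lt hα) hp
    refine ⟨p - q, mem_monomialSpan_of_support fun α hα => ?_, ?_⟩
    · have hαt : α.degree < t + 1 :=
        Submodule.sub_mem _ hp' (rowSpan_le_degreeLT hd hq) hα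
      by_contra! hbox
      refine mem_support_iff.1 hα (hpq ⟨α, mem_degreeLE.2 (Nat.le_of_lt_succ hαt)⟩ fun h => ?_)
      exact hbox _ h rfl
    · have : Ideal.Quotient.mk (systemIdeal f) q = 0 :=
        Ideal.Quotient.eq_zero_iff_mem.2 (rowSpan_le_ideal hq)
      simp [this]
  refine ⟨linearIndependent_of_top_le_span_of_card_eq_finrank hspan.ge ?_, hspan⟩
  rw [hf.finrank_quotient, Fintype.card_coe, card_box ht]

theorem degree_lt_of_mem_finsetBox (ht : t + n = (∑ i, d i) + 1) {α : Col n t}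
    (hα : α ∈ box d t) : (α : Fin n →₀ ℕ).degree < t :=
  degree_lt_of_mem_box ht (by simpa [box] using hα)

/-- The nonvanishing of two minors, for the columns of degree `t` and for those outside the box, and
of the coefficients of the pure powers `x_i^{d_i}` is the open condition under which a system is generic with
the box as a monomial basis. -/
theorem exists_polynomial_isGenericSystem (ht : t + n = (∑ i, d i) + 1) :
    ∃ P : MvPolynomial (Σ i : Fin n, degreeLE n (d i)) ℂ, P ≠ 0 ∧
      ∀ f : Fin n → MvPolynomial (Fin n) ℂ, (∀ i, (f i).totalDegree ≤ d i) →
        eval (coeffVector d f) P ≠ 0 → IsGenericSystem d f ∧ IsQuotientBasis f (box d t) := by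
  classical
  have hbox : ∀ γ : Col n t, γ ∉ box d t → ∃ i, d i ≤ (γ : Fin n →₀ ℕ) i := by
    intro γ hγ
    simpa [box] using hγ
  obtain ⟨ρ₁, h₁⟩ := exists_genericMinor_eval_eq_one (d := d)
    (Subtype.val : {γ : Col n t // (γ : Fin n →₀ ℕ).degree = t} → Col n t)
    Subtype.val_injective fun γ => hbox _ fun h => (degree_lt_of_mem_finsetBox ht h).ne γ.2
  obtain ⟨ρ₂, h₂⟩ := exists_genericMinor_eval_eq_one (d := d)
    (Subtype.val : {γ : Col n t // γ ∉ box d t} → Col n t)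
    Subtype.val_injective fun γ => hbox _ γ.2
  have hsingle : ∀ i, Finsupp.single i (d i) ∈ degreeLE n (d i) := fun i =>
    mem_degreeLE.2 (by simp)
  refine ⟨genericMinor ρ₁ Subtype.val * genericMinor ρ₂ Subtype.val *
    ∏ i, X ⟨i, Finsupp.single i (d i), hsingle i⟩, ?_, ?_⟩
  · intro h
    have := congrArg (eval (coeffVector d fun i => X i ^ d i)) h
    rw [map_mul, map_mul, h₁, h₂, map_prod, map_zero] at this
    simp [coeffVector, X_pow_eq_monomial] at this
  · intro f hd hP
    rw [map_mul, map_mul, map_prod] at hP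
    obtain ⟨hP, hlead⟩ := mul_ne_zero_iff.1 hP
    obtain ⟨hdet₁, hdet₂⟩ := mul_ne_zero_iff.1 hP
    rw [eval_genericMinor hd] at hdet₁ hdet₂
    have hcoeff : ∀ i, coeff (Finsupp.single i (d i)) (f i) ≠ 0 := by
      intro i
      have := Finset.prod_ne_zero_iff.1 hlead i (Finset.mem_univ i)
      rwa [eval_X] at this
    have hdeg : ∀ i, (f i).totalDegree = d i := fun i => by
      refine le_antisymm (hd i) ?_
      have := le_totalDegree (mem_support_iff.2 (hcoeff i))
      rwa [Finsupp.sum_single_index rfl] at this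
    have hle : degreeLT ℂ (Fin n) (t + 1) ≤ rowSpan d f t ⊔ degreeLT ℂ (Fin n) t := by
      intro p hp
      obtain ⟨q, hq, hpq⟩ := exists_mem_rowSpan_of_det_ne_zero hdet₁ p
      rw [← add_sub_cancel q p]
      refine Submodule.add_mem_sup hq fun α hα => ?_
      have hαt : α.degree < t + 1 := Submodule.sub_mem _ hp (rowSpan_le_degreeLT hd hq) hα
      refine (Nat.le_of_lt_succ hαt).lt_of_ne fun h => mem_support_iff.1 hα ?_
      exact hpq ⟨⟨α, mem_degreeLE.2 h.le⟩, h⟩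
    have hinf : ∀ z ∈ projectiveZeros f, z.rep 0 ≠ 0 := fun z hz =>
      rep_zero_ne_zero_of_mem_projectiveZeros hdeg hle hz
    have hgen : IsGenericSystem d f :=
      ⟨fun i h => hcoeff i (by simp [h]), hdeg,
        finite_projectiveZeros (ideal_sup_degreeLT_eq_top hle) hinf, hinf⟩
    refine ⟨hgen, isQuotientBasis_box ht (hgen.isResolvedInDegree ht) hd fun p => ?_⟩
    obtain ⟨q, hq, hpq⟩ := exists_mem_rowSpan_of_det_ne_zero hdet₂ p
    exact ⟨q, hq, fun γ hγ => hpq ⟨γ, hγ⟩⟩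

end Nonvanishing

end Macaulay

theorem mainTheorem1 (n : ℕ) (d : Fin n → ℕ) (t : ℕ) (ht : t + n = (∑ i, d i) + 1) :
    (∀ f : Fin n → MvPolynomial (Fin n) ℂ, Macaulay.IsGenericSystem d f →
      (Macaulay.borderBlock d f t).rank =
          Fintype.card {α : Macaulay.Col n t // (α : Fin n →₀ ℕ).degree = t} ∧
        (∃ O : Finset (Macaulay.Col n t), Macaulay.IsBasisChoice d f t O) ∧
        (Macaulay.IsQuotientBasis f (Macaulay.box d t) →
          Macaulay.IsBasisChoice d f t (Macaulay.box d t))) ∧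
    (∃ P : MvPolynomial (Σ i : Fin n, Macaulay.degreeLE n (d i)) ℂ, P ≠ 0 ∧
      ∀ f : Fin n → MvPolynomial (Fin n) ℂ, (∀ i, (f i).totalDegree ≤ d i) →
        MvPolynomial.eval (Macaulay.coeffVector d f) P ≠ 0 →
          Macaulay.IsGenericSystem d f ∧ Macaulay.IsBasisChoice d f t (Macaulay.box d t)) := by
  have hbox : ∀ f : Fin n → MvPolynomial (Fin n) ℂ, Macaulay.IsGenericSystem d f →
      Macaulay.IsQuotientBasis f (Macaulay.box d t) →
      Macaulay.IsBasisChoice d f t (Macaulay.box d t) := fun f hf hO =>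
    (hf.isResolvedInDegree ht).isBasisChoice (fun i => (hf.totalDegree_eq i).le)
      (fun _ => Macaulay.degree_lt_of_mem_finsetBox ht) hO
  refine ⟨fun f hf => ?_, ?_⟩
  · have hres := hf.isResolvedInDegree ht
    obtain ⟨O, hlt, hO⟩ := Macaulay.exists_quotientBasis hres.degreeLT_le
    exact ⟨Macaulay.borderBlock_rank hres.degreeLT_le,
      ⟨O, hres.isBasisChoice (fun i => (hf.totalDegree_eq i).le) hlt hO⟩, hbox f hf⟩
  · obtain ⟨P, hP, h⟩ := Macaulay.exists_polynomial_isGenericSystem ht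
    refine ⟨P, hP, fun f hd hPf => ?_⟩
    obtain ⟨hgen, hO⟩ := h f hd hPf
    exact ⟨hgen, hbox f hgen hO⟩
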